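/- **Theorem (semi-discrete case).** For all $M>0$ and $R>0$ there exists $C>0$ (depending only on $M$ and $R$) such that the following holds. Let $d\ge 1$ and let $\mu$ be a probability measure on $\mathbb R^d$ whose support is contained in the open ball $B_R$ centered at $0$ with radius $R$, and which has a density with respect to the Lebesgue measure bounded above by $M$. Let $m>1$, let $y_1,\dots,y_m\in B_R$, let $b_1,\dots,b_m>0$ with $\sum_{j=1}^m b_j=1$, and let $\nu=\sum_{j=1}^m b_j\delta_{y_j}$. Let $\Gamma_0(\mathbb R^d)$ be the set of proper lower semicontinuous convex functions $\mathbb R^d\to\mathbb R\cup\{+\infty\}$, write $\varphi^*(y)=\sup_{x}\langle x,y\rangle-\varphi(x)$, and let $\bar\varphi$ be an optimal Brenier potential for $\mu$ and $\nu$, that is, a minimizer of $$\int\varphi\,d\mu+\int\varphi^*\,d\nu\qquad\text{over }\varphi\in\Gamma_0(\mathbb R^d).$$ Then $\bar\varphi$ is differentiable at $\mu$-almost every point, and the following estimate holds for every $n\ge 1$. Let $X_1,\dots,X_n$ be i.i.d. random variables with law $\mu$. Let $(\hat f,\hat g)\in\mathbb R^n\times\mathbb R^m$ be an optimal solution, with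 $\hat g$ depending measurably on the randomness, of the dual linear program for $\hat\mu_n=\frac1n\sum_{i=1}^n\delta_{X_i}$ and $\nu$, $$\max\Big\{\tfrac1n\sum_{i=1}^n f_i+\sum_{j=1}^m b_jg_j\ \Big|\ f_i+g_j\le\tfrac12\|X_i-y_j\|^2\ \text{ for all } i,j\Big\},$$ let $\varphi_{\hat g}(x)=\max_{1\le k\le m}\big(\langle x,y_k\rangle+\hat g_k-\tfrac12\|y_k\|^2\big)$, and let $\hat T_n$ be any selection of the subdifferential of $\varphi_{\hat g}$, i.e. $\hat T_n(x)\in\partial\varphi_{\hat g}(x)$ for all $x\in\mathbb R^d$ (for instance the average of the $y_j$ over the indices $j$ attaining the maximum in $\varphi_{\hat g}(x)$). Then $$\mathbb E\left[\int_{\mathbb R^d}\big\|\nabla\bar\varphi(x)-\hat T_n(x)\big\|\,d\mu(x)\right]\le C\left(\frac mn\right)^{1/8}.$$ -/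

import Mathlib

open MeasureTheory ProbabilityTheory Filter Topology
open scoped ENNReal RealInnerProductSpace

noncomputable section

namespace SemiDiscreteOT

/-- `Γ₀(E)`: proper, lower semicontinuous, convex functions `E → ℝ ∪ {+∞}`.
Convexity is convexity of the epigraph. -/
structure IsGammaZero {E : Type*} [NormedAddCommGroup E] [InnerProductSpace ℝ E]
    (φ : E → EReal) : Prop where
  ne_bot : ∀ x, φ x ≠ ⊥
  exists_ne_top : ∃ x, φ x ≠ ⊤
  lowerSemicontinuous : LowerSemicontinuous φ
  convex_epigraph : Convex ℝ {p : E × ℝ | φ p.1 ≤ (p.2 : EReal)}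

/-- The Fenchel-Legendre transform `φ*(y) = sup_x ⟨x, y⟩ - φ(x)`. -/
def fenchelConj {E : Type*} [NormedAddCommGroup E] [InnerProductSpace ℝ E]
    (φ : E → EReal) (y : E) : EReal :=
  ⨆ x : E, ((⟪x, y⟫ : ℝ) : EReal) - φ x

/-- The integral of an extended real valued function, `∫ φ⁺ dμ - ∫ φ⁻ dμ`.
For `φ ∈ Γ₀` (which has an affine minorant) and a compactly supported finite measure
the second term is finite, so the value is the usual integral in `(-∞, +∞]`. -/
def extIntegral {E : Type*} [MeasurableSpace E] (μ : Measure E) (φ : E → EReal) : EReal :=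
  ((∫⁻ x, (φ x).toENNReal ∂μ : ℝ≥0∞) : EReal) - ((∫⁻ x, (-φ x).toENNReal ∂μ : ℝ≥0∞) : EReal)

/-- The objective `∫ φ dμ + ∫ φ* dν` of the (semi-)dual problem. -/
def dualObjective {E : Type*} [NormedAddCommGroup E] [InnerProductSpace ℝ E] [MeasurableSpace E]
    (μ ν : Measure E) (φ : E → EReal) : EReal :=
  extIntegral μ φ + extIntegral ν (fenchelConj φ)

/-- `φ` is an optimal Brenier potential for `μ` and `ν`: it minimizes `∫ φ dμ + ∫ φ* dν`
over `Γ₀`. -/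
def IsBrenierPotential {E : Type*} [NormedAddCommGroup E] [InnerProductSpace ℝ E]
    [MeasurableSpace E] (μ ν : Measure E) (φ : E → EReal) : Prop :=
  IsGammaZero φ ∧ ∀ ψ : E → EReal, IsGammaZero ψ → dualObjective μ ν φ ≤ dualObjective μ ν ψ

/-- `φ` is finite in a neighbourhood of `x` and differentiable at `x`. -/
def IsDifferentiableAt {E : Type*} [NormedAddCommGroup E] [InnerProductSpace ℝ E]
    (φ : E → EReal) (x : E) : Prop :=
  (∀ᶠ z in 𝓝 x, φ z ≠ ⊥ ∧ φ z ≠ ⊤) ∧ DifferentiableAt ℝ (fun z => (φ z).toReal) x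

/-- The gradient of an extended real valued function
(meaningful where `IsDifferentiableAt` holds). -/
def grad {E : Type*} [NormedAddCommGroup E] [InnerProductSpace ℝ E] [CompleteSpace E]
    (φ : E → EReal) (x : E) : E :=
  gradient (fun z => (φ z).toReal) x

/-- `μ` has a density with respect to the Lebesgue measure that is bounded above by `M`. -/
def HasDensityBoundedBy {d : ℕ} (μ : Measure (EuclideanSpace ℝ (Fin d))) (M : ℝ) : Prop :=
  ∃ ρ : EuclideanSpace ℝ (Fin d) → ℝ≥0∞, Measurable ρ ∧ (∀ x, ρ x ≤ ENNReal.ofReal M) ∧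
    μ = volume.withDensity ρ

/-- The discrete measure `∑ j, b j δ_{y j}`. -/
def discreteMeasure {E : Type*} [MeasurableSpace E] {m : ℕ} (b : Fin m → ℝ) (y : Fin m → E) :
    Measure E :=
  ∑ j, ENNReal.ofReal (b j) • Measure.dirac (y j)

/-- Feasibility in the discrete dual linear program: `f i + g j ≤ ‖x i - y j‖² / 2`. -/
def IsDualFeasible {E : Type*} [NormedAddCommGroup E] {n m : ℕ} (x : Fin n → E) (y : Fin m → E)
    (f : Fin n → ℝ) (g : Fin m → ℝ) : Prop :=
  ∀ i j, f i + g j ≤ 1 / 2 * ‖x i - y j‖ ^ 2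

/-- `(f, g)` is optimal for the discrete dual linear program, which maximizes
`⟨f, a⟩ + ⟨g, b⟩` over feasible pairs, for the measures `∑ i, a i δ_{x i}` and
`∑ j, b j δ_{y j}`. -/
def IsDualOptimal {E : Type*} [NormedAddCommGroup E] {n m : ℕ}
    (a : Fin n → ℝ) (x : Fin n → E) (b : Fin m → ℝ) (y : Fin m → E)
    (f : Fin n → ℝ) (g : Fin m → ℝ) : Prop :=
  IsDualFeasible x y f g ∧
    ∀ f' g', IsDualFeasible x y f' g' →
      ∑ i, f' i * a i + ∑ j, g' j * b j ≤ ∑ i, f i * a i + ∑ j, g j * b j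

/-- The affine function `z ↦ ⟨z, y k⟩ + g k - ‖y k‖² / 2`. -/
def affinePiece {E : Type*} [NormedAddCommGroup E] [InnerProductSpace ℝ E] {m : ℕ}
    (y : Fin m → E) (g : Fin m → ℝ) (k : Fin m) (z : E) : ℝ :=
  ⟪z, y k⟫ + g k - 1 / 2 * ‖y k‖ ^ 2

/-- The explicit potential `φ_g(z) = max_k ⟨z, y k⟩ + g k - ‖y k‖² / 2`. -/
def explicitPotential {E : Type*} [NormedAddCommGroup E] [InnerProductSpace ℝ E] {m : ℕ}
    (y : Fin m → E) (g : Fin m → ℝ) (z : E) : ℝ :=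
  ⨆ k, affinePiece y g k z

/-- The subdifferential of a real valued function. -/
def subdifferential {E : Type*} [NormedAddCommGroup E] [InnerProductSpace ℝ E]
    (φ : E → ℝ) (x : E) : Set E :=
  {v | ∀ z, φ x + ⟪v, z - x⟫ ≤ φ z}

/-- `T` is a Monge map estimator for the discrete measures `∑ i, a i δ_{x i}` and
`∑ j, b j δ_{y j}`, built from `g`: `g` is (the second part of) an optimal solution of the
discrete dual linear program and `T` is a selection of the subdifferential of `φ_g`. -/
def IsMongeMapEstimator {E : Type*} [NormedAddCommGroup E] [InnerProductSpace ℝ E] {n m : ℕ}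
    (a : Fin n → ℝ) (x : Fin n → E) (b : Fin m → ℝ) (y : Fin m → E)
    (g : Fin m → ℝ) (T : E → E) : Prop :=
  (∃ f, IsDualOptimal a x b y f g) ∧ ∀ z, T z ∈ subdifferential (explicitPotential y g) z

open Classical in
/-- The set `I(z)` of active indices. -/
def activeIndices {E : Type*} [NormedAddCommGroup E] [InnerProductSpace ℝ E] {m : ℕ}
    (y : Fin m → E) (g : Fin m → ℝ) (z : E) : Finset (Fin m) :=
  Finset.univ.filter fun j => explicitPotential y g z = affinePiece y g j z

/-- The average of the `y j` over the active indices. -/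
def averageSelection {E : Type*} [NormedAddCommGroup E] [InnerProductSpace ℝ E] {m : ℕ}
    (y : Fin m → E) (g : Fin m → ℝ) (z : E) : E :=
  ((activeIndices y g z).card : ℝ)⁻¹ • ∑ j ∈ activeIndices y g z, y j

/-- The average over the active indices is one of the selections that `IsMongeMapEstimator`
allows. -/
theorem averageSelection_mem_subdifferential {E : Type*} [NormedAddCommGroup E]
    [InnerProductSpace ℝ E] {m : ℕ} (hm : 0 < m) (y : Fin m → E) (g : Fin m → ℝ) (x : E) :
    averageSelection y g x ∈ subdifferential (explicitPotential y g) x := by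
  have : Nonempty (Fin m) := ⟨⟨0, hm⟩⟩
  have hne : (activeIndices y g x).Nonempty := by
    obtain ⟨j, hj⟩ := exists_eq_ciSup_of_finite (f := fun k => affinePiece y g k x)
    exact ⟨j, by simp only [activeIndices, Finset.mem_filter]; exact ⟨Finset.mem_univ _, hj.symm⟩⟩
  intro z
  have hc : (0 : ℝ) < ((activeIndices y g x).card : ℝ) := by exact_mod_cast hne.card_pos
  have key : ∀ j ∈ activeIndices y g x,
      ⟪y j, z - x⟫ ≤ explicitPotential y g z - explicitPotential y g x := by
    intro j hj
    simp only [activeIndices, Finset.mem_filter] at hj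
    have h1 : affinePiece y g j z ≤ explicitPotential y g z :=
      le_ciSup (f := fun k => affinePiece y g k z) (Set.finite_range _).bddAbove j
    rw [hj.2]
    unfold affinePiece at *
    rw [inner_sub_right, real_inner_comm z (y j), real_inner_comm x (y j)]
    linarith
  have hs := Finset.sum_le_sum key
  rw [Finset.sum_const, nsmul_eq_mul] at hs
  have : ⟪averageSelection y g x, z - x⟫
      ≤ explicitPotential y g z - explicitPotential y g x := by
    unfold averageSelection
    rw [real_inner_smul_left, sum_inner, inv_mul_le_iff₀ hc]
    exact hs
  linarith

end SemiDiscreteOT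

end

/-! For a discrete target everything is governed by the weights `g`: the semi-dual objective
`semidual μ b y` is convex in `g`, and an optimal Brenier potential coincides `μ`-a.e. with some
`explicitPotential y g'` that minimizes it and lies below the potential everywhere. The estimator's
weights minimize the same objective with `μ` replaced by the empirical measure.

Stability: a small semi-dual gap forces close gradients (`lintegral_enorm_sub_le_semidual_gap`). The
gap bounds the integrated Jensen gap of `g ↦ φ_g(x)` at the midpoint. An index active at the
midpoint gives a common approximate subgradient of both potentials, and an approximate subgradient
is close to a true one up to second differences with step `t`. These integrate to `O(t ^ 2)`, since
`φ_g` is convex and Lipschitz and `μ` has bounded density. The resulting error is `O(t + gap / t)`.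

Statistics: the gap is at most a difference of deviations between `μ` and the empirical measure.
Modulo constants the optimal weights lie in a bounded box, so a grid, Hoeffding's lemma and an
exponential union bound control the expected gap (`exists_integrable_semidual_gap_bound`). With `s =
(m / n) ^ (1 / 8)` the gap is `O(s ^ 2)`, and `t = s` gives the rate.

The constant is uniform in the dimension because `M` and `R` allow only finitely many dimensions
(`exists_dimension_bound`). -/

noncomputable section

namespace SemiDiscreteOT

/-! ### Elementary properties of the max-affine potentials. -/

section Potential

variable {E : Type*} [NormedAddCommGroup E] [InnerProductSpace ℝ E] {m : ℕ}

theorem affinePiece_le_explicitPotential (y : Fin m → E) (g : Fin m → ℝ) (k : Fin m) (z : E) :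
    affinePiece y g k z ≤ explicitPotential y g z :=
  le_ciSup (f := fun k => affinePiece y g k z) (Set.finite_range _).bddAbove k

theorem exists_affinePiece_eq_explicitPotential [NeZero m] (y : Fin m → E) (g : Fin m → ℝ)
    (z : E) : ∃ k, affinePiece y g k z = explicitPotential y g z :=
  exists_eq_ciSup_of_finite (f := fun k => affinePiece y g k z)

theorem explicitPotential_le [NeZero m] {y : Fin m → E} {g : Fin m → ℝ} {z : E} {c : ℝ}
    (h : ∀ k, affinePiece y g k z ≤ c) : explicitPotential y g z ≤ c :=
  ciSup_le h

theorem affinePiece_apply_add (y : Fin m → E) (g : Fin m → ℝ) (k : Fin m) (x u : E) :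
    affinePiece y g k (x + u) = affinePiece y g k x + ⟪y k, u⟫ := by
  simp only [affinePiece, inner_add_left, real_inner_comm u (y k)]
  ring

theorem affinePiece_apply (y : Fin m → E) (g : Fin m → ℝ) (k : Fin m) (x z : E) :
    affinePiece y g k z = affinePiece y g k x + ⟪y k, z - x⟫ := by
  rw [← affinePiece_apply_add, add_sub_cancel]

theorem mem_subdifferential_of_affinePiece_eq {y : Fin m → E} {g : Fin m → ℝ} {k : Fin m} {x : E}
    (h : affinePiece y g k x = explicitPotential y g x) :
    y k ∈ subdifferential (explicitPotential y g) x := fun z => by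
  rw [← h, ← affinePiece_apply]
  exact affinePiece_le_explicitPotential y g k z

theorem explicitPotential_sub_le [NeZero m] {y : Fin m → E} {R : ℝ} (hy : ∀ j, ‖y j‖ ≤ R)
    (g : Fin m → ℝ) (x z : E) :
    explicitPotential y g x - explicitPotential y g z ≤ R * ‖x - z‖ := by
  obtain ⟨k, hk⟩ := exists_affinePiece_eq_explicitPotential y g x
  have h1 := affinePiece_le_explicitPotential y g k z
  have h2 := affinePiece_apply y g k z x
  have h3 : ⟪y k, x - z⟫ ≤ R * ‖x - z‖ :=
    (real_inner_le_norm _ _).trans (mul_le_mul_of_nonneg_right (hy k) (norm_nonneg _))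
  linarith

theorem abs_explicitPotential_sub_le [NeZero m] {y : Fin m → E} {R : ℝ} (hy : ∀ j, ‖y j‖ ≤ R)
    (g : Fin m → ℝ) (x z : E) :
    |explicitPotential y g x - explicitPotential y g z| ≤ R * ‖x - z‖ := by
  rw [abs_le]
  have h1 := explicitPotential_sub_le hy g x z
  have h2 := explicitPotential_sub_le hy g z x
  rw [norm_sub_rev] at h2
  constructor <;> linarith

theorem explicitPotential_le_of_le [NeZero m] (y : Fin m → E) {g g' : Fin m → ℝ} {ε : ℝ}
    (h : ∀ j, g j ≤ g' j + ε) (x : E) :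
    explicitPotential y g x ≤ explicitPotential y g' x + ε := by
  refine explicitPotential_le fun k => ?_
  have h1 := affinePiece_le_explicitPotential y g' k x
  have h2 := h k
  unfold affinePiece at *
  linarith

theorem continuous_explicitPotential [NeZero m] (y : Fin m → E) (g : Fin m → ℝ) :
    Continuous (explicitPotential y g) := by
  have h : ∀ j, ‖y j‖ ≤ ∑ i, ‖y i‖ := fun j =>
    Finset.single_le_sum (f := fun i => ‖y i‖) (fun i _ => norm_nonneg _) (Finset.mem_univ j)
  have : LipschitzWith (Real.toNNReal (∑ i, ‖y i‖)) (explicitPotential y g) := by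
    refine LipschitzWith.of_dist_le_mul fun x z => ?_
    rw [Real.dist_eq, dist_eq_norm, Real.coe_toNNReal _ (by positivity)]
    exact abs_explicitPotential_sub_le h g x z
  exact this.continuous

theorem convexOn_explicitPotential [NeZero m] (y : Fin m → E) (g : Fin m → ℝ) :
    ConvexOn ℝ Set.univ (explicitPotential y g) := by
  refine ⟨convex_univ, fun x _ z _ a b ha hb hab => explicitPotential_le fun k => ?_⟩
  have h1 := mul_le_mul_of_nonneg_left (affinePiece_le_explicitPotential y g k x) ha
  have h2 := mul_le_mul_of_nonneg_left (affinePiece_le_explicitPotential y g k z) hb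
  have h3 : affinePiece y g k (a • x + b • z)
      = a * affinePiece y g k x + b * affinePiece y g k z := by
    simp only [affinePiece, inner_add_left, real_inner_smul_left]
    linear_combination (g k - 1 / 2 * ‖y k‖ ^ 2) * (-hab)
  rw [h3]
  simp only [smul_eq_mul]
  linarith

theorem abs_explicitPotential_le [NeZero m] {y : Fin m → E} {R B : ℝ} (hy : ∀ j, ‖y j‖ ≤ R)
    {g : Fin m → ℝ} (hg : ∀ j, |g j| ≤ B) {x : E} (hx : ‖x‖ ≤ R) :
    |explicitPotential y g x| ≤ 3 / 2 * R ^ 2 + B := by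
  obtain ⟨k, hk⟩ := exists_affinePiece_eq_explicitPotential y g x
  have h0 : 0 ≤ R := (norm_nonneg x).trans hx
  have h1 : |⟪x, y k⟫| ≤ R * R :=
    (abs_real_inner_le_norm _ _).trans (mul_le_mul hx (hy k) (norm_nonneg _) h0)
  have h2 : ‖y k‖ ^ 2 ≤ R ^ 2 := pow_le_pow_left₀ (norm_nonneg _) (hy k) 2
  have h3 := sq_nonneg ‖y k‖
  have h4 := hg k
  rw [← hk, affinePiece]
  rw [abs_le] at *
  constructor <;> nlinarith

theorem norm_le_of_mem_subdifferential [NeZero m] {y : Fin m → E} {R : ℝ} (hy : ∀ j, ‖y j‖ ≤ R)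
    {g : Fin m → ℝ} {x v : E} (hv : v ∈ subdifferential (explicitPotential y g) x) :
    ‖v‖ ≤ R := by
  -- Testing at `x + v` gives `‖v‖ ^ 2 ≤ R * ‖v‖`.
  have h1 := hv (x + v)
  have h2 := explicitPotential_sub_le hy g (x + v) x
  rw [add_sub_cancel_left] at h1 h2
  rw [real_inner_self_eq_norm_sq] at h1
  by_contra! h
  have h0 : 0 ≤ R := (norm_nonneg _).trans (hy 0)
  nlinarith

theorem isGammaZero_explicitPotential [NeZero m] (y : Fin m → E) (g : Fin m → ℝ) :
    IsGammaZero fun x => (explicitPotential y g x : EReal) where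
  ne_bot _ := EReal.coe_ne_bot _
  exists_ne_top := ⟨0, EReal.coe_ne_top _⟩
  lowerSemicontinuous :=
    (continuous_coe_real_ereal.comp (continuous_explicitPotential y g)).lowerSemicontinuous
  convex_epigraph := by
    have := (convexOn_explicitPotential y g).convex_epigraph
    simpa using this

theorem fenchelConj_explicitPotential_le [NeZero m] (y : Fin m → E) (g : Fin m → ℝ) (j : Fin m) :
    fenchelConj (fun x => (explicitPotential y g x : EReal)) (y j)
      ≤ ((1 / 2 * ‖y j‖ ^ 2 - g j : ℝ) : EReal) := by
  refine iSup_le fun x => ?_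
  rw [← EReal.coe_sub, EReal.coe_le_coe_iff]
  have := affinePiece_le_explicitPotential y g j x
  unfold affinePiece at this
  linarith

end Potential

/-! ### Second differences and approximate subgradients. -/

section SecondDifference

variable {E : Type*} [NormedAddCommGroup E] [InnerProductSpace ℝ E]

/-- The centred second difference of `φ` at `x` with step `h`. -/
def secondDiff {E : Type*} [NormedAddCommGroup E] (φ : E → ℝ) (h x : E) : ℝ :=
  (φ (x + h) - φ x) - (φ x - φ (x - h))

theorem continuous_secondDiff {E : Type*} [NormedAddCommGroup E] {φ : E → ℝ}
    (hφ : Continuous φ) (h : E) :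
    Continuous (secondDiff φ h) := by
  unfold secondDiff
  fun_prop

theorem secondDiff_nonneg {φ : E → ℝ} (hφ : ConvexOn ℝ Set.univ φ) (h x : E) :
    0 ≤ secondDiff φ h x := by
  have := hφ.2 (Set.mem_univ (x + h)) (Set.mem_univ (x - h))
    (by norm_num : (0 : ℝ) ≤ 1 / 2) (by norm_num : (0 : ℝ) ≤ 1 / 2) (by norm_num)
  have h2 : (1 / 2 : ℝ) • (x + h) + (1 / 2 : ℝ) • (x - h) = x := by module
  rw [h2] at this
  simp only [smul_eq_mul] at this
  unfold secondDiff
  linarith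

/-- An approximate subgradient and a subgradient at the same point differ, in the direction `h`,
by at most the second difference plus the error. -/
theorem abs_inner_sub_le_secondDiff {φ : E → ℝ} {x p v : E} {ε : ℝ}
    (hp : ∀ z, φ x + ⟪p, z - x⟫ - ε ≤ φ z) (hv : v ∈ subdifferential φ x) (h : E) :
    |⟪h, p - v⟫| ≤ secondDiff φ h x + ε := by
  have e1 := hp (x + h)
  have e2 := hp (x - h)
  have e3 := hv (x + h)
  have e4 := hv (x - h)
  have e5 : x - h - x = -h := by abel
  rw [add_sub_cancel_left] at e1 e3
  rw [e5, inner_neg_right] at e2 e4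
  rw [inner_sub_right, real_inner_comm p h, real_inner_comm v h, abs_le]
  unfold secondDiff
  constructor <;> linarith

end SecondDifference

/-! ### Second differences under a bounded density, and stability of subgradients. -/

section Euclidean

variable {d : ℕ}

local notation "𝔼" => EuclideanSpace ℝ (Fin d)

theorem norm_le_sum_abs (x : 𝔼) : ‖x‖ ≤ ∑ i, |x i| := by
  have h : x = ∑ i, x i • EuclideanSpace.single i (1 : ℝ) := by
    ext j
    simp [Finset.sum_apply, Pi.single_apply]
  calc ‖x‖ = ‖∑ i, x i • EuclideanSpace.single i (1 : ℝ)‖ := by rw [← h]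
    _ ≤ ∑ i, ‖x i • EuclideanSpace.single i (1 : ℝ)‖ := norm_sum_le _ _
    _ = ∑ i, |x i| := by simp [norm_smul]

theorem norm_sub_le_sum_secondDiff {φ : 𝔼 → ℝ} {x p v : 𝔼} {ε : ℝ}
    (hp : ∀ z, φ x + ⟪p, z - x⟫ - ε ≤ φ z) (hv : v ∈ subdifferential φ x) {t : ℝ} (ht : 0 < t) :
    ‖p - v‖ ≤ ∑ i, (secondDiff φ (t • EuclideanSpace.single i (1 : ℝ)) x + ε) / t := by
  refine (norm_le_sum_abs _).trans (Finset.sum_le_sum fun i _ => ?_)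
  have := abs_inner_sub_le_secondDiff hp hv (t • EuclideanSpace.single i (1 : ℝ))
  rw [real_inner_smul_left, EuclideanSpace.inner_single_left, abs_mul, abs_of_pos ht] at this
  rw [le_div_iff₀ ht, mul_comm]
  simpa using this

theorem le_smul_restrict_ball {μ : Measure 𝔼} {M R : ℝ} (hμ : ∀ᵐ x ∂μ, x ∈ Metric.ball (0 : 𝔼) R)
    (h : HasDensityBoundedBy μ M) :
    μ ≤ ENNReal.ofReal M • volume.restrict (Metric.ball (0 : 𝔼) R) := by
  obtain ⟨ρ, -, hρM, rfl⟩ := h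
  rw [← Measure.restrict_eq_self_of_ae_mem hμ, ← Measure.restrict_smul]
  refine Measure.restrict_mono_measure ?_ _
  rw [← withDensity_const]
  exact withDensity_mono (ae_of_all _ hρM)

theorem integrable_of_continuous {μ : Measure 𝔼} [IsFiniteMeasure μ] {R : ℝ}
    (hμ : ∀ᵐ x ∂μ, x ∈ Metric.ball (0 : 𝔼) R) {f : 𝔼 → ℝ} (hf : Continuous f) :
    Integrable f μ := by
  have h : ∀ᵐ x ∂μ, x ∈ Metric.closedBall (0 : 𝔼) R := by
    filter_upwards [hμ] with x hx using Metric.ball_subset_closedBall hx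
  rw [← Measure.restrict_eq_self_of_ae_mem h]
  exact hf.continuousOn.integrableOn_compact (isCompact_closedBall _ _)

/-- The cutoff `max 0 (R + 1 - ‖x‖)`. -/
def cutoff (R : ℝ) (x : 𝔼) : ℝ := max 0 (R + 1 - ‖x‖)

theorem continuous_cutoff (R : ℝ) : Continuous (cutoff R : 𝔼 → ℝ) := by
  unfold cutoff
  fun_prop

theorem cutoff_eq_zero {R : ℝ} {x : 𝔼} (hx : R + 1 ≤ ‖x‖) : cutoff R x = 0 :=
  max_eq_left (by linarith)

theorem abs_cutoff_sub_le (R : ℝ) (x z : 𝔼) : |cutoff R x - cutoff R z| ≤ ‖x - z‖ := by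
  unfold cutoff
  rw [max_comm, max_comm (0 : ℝ)]
  refine (abs_max_sub_max_le_abs _ _ _).trans ?_
  rw [sub_sub_sub_cancel_left, norm_sub_rev x z]
  exact abs_norm_sub_norm_le _ _

theorem integrable_cutoff_mul (R : ℝ) {f : 𝔼 → ℝ} (hf : Continuous f) :
    Integrable (fun x => cutoff R x * f x) := by
  refine ((continuous_cutoff R).mul hf).integrable_of_hasCompactSupport ?_
  refine HasCompactSupport.intro (isCompact_closedBall (0 : 𝔼) (R + 1)) fun x hx => ?_
  rw [mem_closedBall_zero_iff, not_le] at hx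
  simp [cutoff_eq_zero hx.le]

/-- Discrete integration by parts: a translation moves one of the two differences from `φ` onto the
cutoff. Both are Lipschitz, so each difference contributes a factor `‖h‖`; bounding the second
difference pointwise would give only one. -/
theorem integral_cutoff_mul_secondDiff_le {R L : ℝ} {φ : 𝔼 → ℝ} (hφ : Continuous φ)
    (hlip : ∀ x z, |φ x - φ z| ≤ L * ‖x - z‖) {h : 𝔼} (hh : ‖h‖ ≤ 1) :
    ∫ x, cutoff R x * secondDiff φ h x
      ≤ L * ‖h‖ ^ 2 * volume.real (Metric.ball (0 : 𝔼) (R + 2)) := by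
  have i1 : Integrable fun x => cutoff R x * (φ (x + h) - φ x) :=
    integrable_cutoff_mul R (by fun_prop)
  have i2 : Integrable fun x => cutoff R x * (φ x - φ (x - h)) :=
    integrable_cutoff_mul R (by fun_prop)
  have i3 : Integrable fun x => cutoff R (x + h) * (φ (x + h) - φ x) := by
    have := i2.comp_add_right h
    simpa using this
  have e2 : ∫ x, cutoff R x * (φ x - φ (x - h))
      = ∫ x, cutoff R (x + h) * (φ (x + h) - φ x) := by
    rw [← integral_add_right_eq_self _ h]
    simp
  calc ∫ x, cutoff R x * secondDiff φ h x
      = ∫ x, (cutoff R x * (φ (x + h) - φ x) - cutoff R x * (φ x - φ (x - h))) := by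
        simp only [secondDiff, mul_sub]
    _ = ∫ x, (cutoff R x * (φ (x + h) - φ x) - cutoff R (x + h) * (φ (x + h) - φ x)) := by
        rw [integral_sub i1 i2, integral_sub i1 i3, e2]
    _ ≤ ∫ x, (Metric.ball (0 : 𝔼) (R + 2)).indicator (fun _ => L * ‖h‖ ^ 2) x := by
        refine integral_mono (i1.sub i3) ?_ fun x => ?_
        · exact (integrable_indicator_iff measurableSet_ball).2
            (integrableOn_const (measure_ball_lt_top.ne))
        · dsimp only
          rw [← sub_mul]
          -- The cutoff vanishes outside radius `R + 1` and `‖h‖ ≤ 1`, so both cutoff values are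
          -- zero outside radius `R + 2`.
          by_cases hx : x ∈ Metric.ball (0 : 𝔼) (R + 2)
          · rw [Set.indicator_of_mem hx]
            have a1 := abs_cutoff_sub_le R x (x + h)
            have a2 := hlip (x + h) x
            rw [sub_add_cancel_left, norm_neg] at a1
            rw [add_sub_cancel_left] at a2
            refine (le_abs_self _).trans ?_
            rw [abs_mul]
            calc _ ≤ ‖h‖ * (L * ‖h‖) := mul_le_mul a1 a2 (abs_nonneg _) (norm_nonneg _)
              _ = _ := by ring
          · rw [Set.indicator_of_notMem hx]
            rw [mem_ball_zero_iff, not_lt] at hx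
            have : ‖x‖ - ‖h‖ ≤ ‖x + h‖ := by
              have := norm_sub_le (x + h) h
              rw [add_sub_cancel_right] at this
              linarith
            rw [cutoff_eq_zero (by linarith), cutoff_eq_zero (by linarith)]
            simp
    _ = L * ‖h‖ ^ 2 * volume.real (Metric.ball (0 : 𝔼) (R + 2)) := by
        rw [integral_indicator_const _ measurableSet_ball, smul_eq_mul, mul_comm]

/-- Convexity makes the second difference nonnegative, so `μ` may be replaced by the larger weight
`M * cutoff R`, the cutoff being at least `1` on the ball of radius `R`. -/
theorem integral_secondDiff_le {μ : Measure 𝔼} [IsFiniteMeasure μ] {M R L : ℝ} (hM : 0 ≤ M)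
    (hL : 0 ≤ L)
    (hμ : μ ≤ ENNReal.ofReal M • volume.restrict (Metric.ball (0 : 𝔼) R))
    {φ : 𝔼 → ℝ} (hφ : Continuous φ) (hconv : ConvexOn ℝ Set.univ φ)
    (hlip : ∀ x z, |φ x - φ z| ≤ L * ‖x - z‖) {h : 𝔼} (hh : ‖h‖ ≤ 1) :
    ∫ x, secondDiff φ h x ∂μ
      ≤ M * (L * ‖h‖ ^ 2 * volume.real (Metric.ball (0 : 𝔼) (R + 2))) := by
  have hcs := continuous_secondDiff hφ h
  have hnn : ∀ x, 0 ≤ secondDiff φ h x := secondDiff_nonneg hconv h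
  have hcn : ∀ x : 𝔼, 0 ≤ cutoff R x * secondDiff φ h x := fun x =>
    mul_nonneg (le_max_left _ _) (hnn x)
  have key : ∫⁻ x, ENNReal.ofReal (secondDiff φ h x) ∂μ
      ≤ ENNReal.ofReal (M * (L * ‖h‖ ^ 2 * volume.real (Metric.ball (0 : 𝔼) (R + 2)))) := by
    calc ∫⁻ x, ENNReal.ofReal (secondDiff φ h x) ∂μ
        ≤ ∫⁻ x, ENNReal.ofReal (secondDiff φ h x)
            ∂(ENNReal.ofReal M • volume.restrict (Metric.ball (0 : 𝔼) R)) :=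
          lintegral_mono' hμ le_rfl
      _ = ENNReal.ofReal M * ∫⁻ x in Metric.ball (0 : 𝔼) R,
            ENNReal.ofReal (secondDiff φ h x) := by
          rw [lintegral_smul_measure, smul_eq_mul]
      _ ≤ ENNReal.ofReal M * ∫⁻ x, ENNReal.ofReal (cutoff R x * secondDiff φ h x) := by
          refine mul_le_mul_right ?_ _
          refine (setLIntegral_mono' (measurableSet_ball (x := (0 : 𝔼)) (ε := R))
            fun x hx => ?_).trans (setLIntegral_le_lintegral _ _)
          refine ENNReal.ofReal_le_ofReal (le_mul_of_one_le_left (hnn x) ?_)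
          rw [mem_ball_zero_iff] at hx
          exact (by linarith : (1 : ℝ) ≤ R + 1 - ‖x‖).trans (le_max_right _ _)
      _ = ENNReal.ofReal M * ENNReal.ofReal (∫ x, cutoff R x * secondDiff φ h x) := by
          rw [ofReal_integral_eq_lintegral_ofReal (integrable_cutoff_mul R hcs)
            (ae_of_all _ hcn)]
      _ ≤ _ := by
          rw [← ENNReal.ofReal_mul hM]
          exact ENNReal.ofReal_le_ofReal (mul_le_mul_of_nonneg_left
            (integral_cutoff_mul_secondDiff_le hφ hlip hh) hM)
  rw [integral_eq_lintegral_of_nonneg_ae (ae_of_all _ hnn) hcs.aestronglyMeasurable]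
  refine ENNReal.toReal_le_of_le_ofReal (by positivity) key

/-- The semi-dual objective `∫ φ_g dμ + ∑ j, b j (‖y j‖² / 2 - g j)`. -/
def semidual {m : ℕ} (μ : Measure 𝔼) (b : Fin m → ℝ) (y : Fin m → 𝔼) (g : Fin m → ℝ) : ℝ :=
  ∫ x, explicitPotential y g x ∂μ + ∑ j, b j * (1 / 2 * ‖y j‖ ^ 2 - g j)

/-- Jensen gap of `g ↦ φ_g(x)` between `g` and `g'`. -/
def midpointGap {m : ℕ} (y : Fin m → 𝔼) (g g' : Fin m → ℝ) (x : 𝔼) : ℝ :=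
  (explicitPotential y g x + explicitPotential y g' x) / 2
    - explicitPotential y (fun j => (g j + g' j) / 2) x

theorem continuous_midpointGap {m : ℕ} [NeZero m] (y : Fin m → 𝔼) (g g' : Fin m → ℝ) :
    Continuous (midpointGap y g g') := by
  have h1 := continuous_explicitPotential y g
  have h2 := continuous_explicitPotential y g'
  have h3 := continuous_explicitPotential y fun j => (g j + g' j) / 2
  unfold midpointGap
  fun_prop

/-- If `k` is active at `x` for the midpoint weights, twice the Jensen gap is the sum of the defects
`φ_g(x) - affinePiece y g k x` and its analogue for `g'`. Both are nonnegative, so `y k` is a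
subgradient of each potential up to that error, and the triangle inequality passes through `y k`. -/
theorem norm_sub_le_of_mem_subdifferential {m : ℕ} [NeZero m] {y : Fin m → 𝔼} {g g' : Fin m → ℝ}
    {x v w : 𝔼} (hv : v ∈ subdifferential (explicitPotential y g) x)
    (hw : w ∈ subdifferential (explicitPotential y g') x) {t : ℝ} (ht : 0 < t) :
    ‖w - v‖ ≤ ∑ i, (secondDiff (explicitPotential y g) (t • EuclideanSpace.single i (1 : ℝ)) x
      + secondDiff (explicitPotential y g') (t • EuclideanSpace.single i (1 : ℝ)) x
      + 4 * midpointGap y g g' x) / t := by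
  obtain ⟨k, hk⟩ :=
    exists_affinePiece_eq_explicitPotential y (fun j => (g j + g' j) / 2) x
  have h1 := affinePiece_le_explicitPotential y g k x
  have h2 := affinePiece_le_explicitPotential y g' k x
  have h3 : affinePiece y (fun j => (g j + g' j) / 2) k x
      = (affinePiece y g k x + affinePiece y g' k x) / 2 := by
    simp only [affinePiece]
    ring
  have e1 := norm_sub_le_sum_secondDiff (φ := explicitPotential y g) (p := y k)
    (ε := 2 * midpointGap y g g' x) (fun z => by
      have a1 := affinePiece_le_explicitPotential y g k z
      have a2 := affinePiece_apply y g k x z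
      unfold midpointGap
      linarith) hv ht
  have e2 := norm_sub_le_sum_secondDiff (φ := explicitPotential y g') (p := y k)
    (ε := 2 * midpointGap y g g' x) (fun z => by
      have a1 := affinePiece_le_explicitPotential y g' k z
      have a2 := affinePiece_apply y g' k x z
      unfold midpointGap
      linarith) hw ht
  have e3 : ‖w - v‖ ≤ ‖y k - v‖ + ‖y k - w‖ := by
    rw [← sub_sub_sub_cancel_left v w (y k)]
    exact norm_sub_le _ _
  refine e3.trans ((add_le_add e1 e2).trans (le_of_eq ?_))
  rw [← Finset.sum_add_distrib]
  refine Finset.sum_congr rfl fun i _ => ?_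
  ring

/-- Stability of the subgradients of `φ_g` around a minimizer of the semi-dual objective. -/
theorem lintegral_enorm_sub_le_semidual_gap {m : ℕ} [NeZero m] {μ : Measure 𝔼}
    [IsProbabilityMeasure μ] {M R : ℝ} (hM : 0 ≤ M) (hR : 0 ≤ R)
    (hball : ∀ᵐ x ∂μ, x ∈ Metric.ball (0 : 𝔼) R) (hdens : HasDensityBoundedBy μ M)
    {b : Fin m → ℝ} {y : Fin m → 𝔼} (hy : ∀ j, ‖y j‖ ≤ R) {g g' : Fin m → ℝ}
    (hmin : ∀ h, semidual μ b y g' ≤ semidual μ b y h) {v w : 𝔼 → 𝔼}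
    (hv : ∀ x, v x ∈ subdifferential (explicitPotential y g) x)
    (hw : ∀ᵐ x ∂μ, w x ∈ subdifferential (explicitPotential y g') x)
    {t : ℝ} (ht : 0 < t) (ht1 : t ≤ 1) :
    ∫⁻ x, ‖w x - v x‖ₑ ∂μ ≤ ENNReal.ofReal (d *
      (2 * (M * (R * volume.real (Metric.ball (0 : 𝔼) (R + 2)))) * t
        + 2 * (semidual μ b y g - semidual μ b y g') / t)) := by
  have hle := le_smul_restrict_ball hball hdens
  set V := volume.real (Metric.ball (0 : 𝔼) (R + 2)) with hV
  have cont := continuous_explicitPotential y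
  have hφint : ∀ g, Integrable (explicitPotential y g) μ := fun g =>
    integrable_of_continuous hball (cont g)
  have hsd : ∀ g (i : Fin d),
      Integrable (secondDiff (explicitPotential y g) (t • EuclideanSpace.single i (1 : ℝ))) μ :=
    fun g i => integrable_of_continuous hball (continuous_secondDiff (cont g) _)
  have hsdle : ∀ g (i : Fin d),
      ∫ x, secondDiff (explicitPotential y g) (t • EuclideanSpace.single i (1 : ℝ)) x ∂μ
        ≤ M * (R * t ^ 2 * V) := fun g i => by
    have hn : ‖t • EuclideanSpace.single i (1 : ℝ)‖ = t := by
      simp [norm_smul, abs_of_pos ht]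
    have := integral_secondDiff_le hM hR hle (cont g) (convexOn_explicitPotential y g)
      (abs_explicitPotential_sub_le hy g) (h := t • EuclideanSpace.single i (1 : ℝ))
      (by rw [hn]; exact ht1)
    rwa [hn] at this
  have hgi : Integrable (midpointGap y g g') μ :=
    integrable_of_continuous hball (continuous_midpointGap y g g')
  -- Minimality of `g'` is tested at the midpoint; the part of `semidual` that is affine in the
  -- weights has no Jensen gap.
  have hgap : 2 * ∫ x, midpointGap y g g' x ∂μ ≤ semidual μ b y g - semidual μ b y g' := by
    have h1 := hmin fun j => (g j + g' j) / 2
    have h2 : ∫ x, midpointGap y g g' x ∂μ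
        = (∫ x, explicitPotential y g x ∂μ + ∫ x, explicitPotential y g' x ∂μ) / 2
          - ∫ x, explicitPotential y (fun j => (g j + g' j) / 2) x ∂μ := by
      unfold midpointGap
      rw [integral_sub (((hφint g).fun_add (hφint g')).div_const 2) (hφint _), integral_div,
        integral_add (hφint g) (hφint g')]
    have h3 : ∑ j, b j * (1 / 2 * ‖y j‖ ^ 2 - (g j + g' j) / 2)
        = (∑ j, b j * (1 / 2 * ‖y j‖ ^ 2 - g j) + ∑ j, b j * (1 / 2 * ‖y j‖ ^ 2 - g' j)) / 2 := by
      rw [← Finset.sum_add_distrib, Finset.sum_div]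
      exact Finset.sum_congr rfl fun j _ => by ring
    unfold semidual at *
    rw [h3] at h1
    rw [h2]
    linarith
  set F : 𝔼 → ℝ := fun x =>
    ∑ i, (secondDiff (explicitPotential y g) (t • EuclideanSpace.single i (1 : ℝ)) x
      + secondDiff (explicitPotential y g') (t • EuclideanSpace.single i (1 : ℝ)) x
      + 4 * midpointGap y g g' x) / t with hF
  have hpt : ∀ᵐ x ∂μ, ‖w x - v x‖ ≤ F x := by
    filter_upwards [hw] with x hx using norm_sub_le_of_mem_subdifferential (hv x) hx ht
  have hFi' : ∀ i ∈ (Finset.univ : Finset (Fin d)), Integrable (fun x =>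
      (secondDiff (explicitPotential y g) (t • EuclideanSpace.single i (1 : ℝ)) x
      + secondDiff (explicitPotential y g') (t • EuclideanSpace.single i (1 : ℝ)) x
      + 4 * midpointGap y g g' x) / t) μ := fun i _ =>
    (((hsd g i).add (hsd g' i)).add (hgi.const_mul 4)).div_const t
  have hFi : Integrable F μ := integrable_finsetSum _ hFi'
  calc ∫⁻ x, ‖w x - v x‖ₑ ∂μ ≤ ∫⁻ x, ENNReal.ofReal (F x) ∂μ := by
        refine lintegral_mono_ae ?_
        filter_upwards [hpt] with x hx
        rw [← ofReal_norm]
        exact ENNReal.ofReal_le_ofReal hx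
    _ = ENNReal.ofReal (∫ x, F x ∂μ) := by
        rw [ofReal_integral_eq_lintegral_ofReal hFi]
        filter_upwards [hpt] with x hx using (norm_nonneg _).trans hx
    _ ≤ _ := by
        refine ENNReal.ofReal_le_ofReal ?_
        rw [hF, integral_finsetSum _ hFi']
        have : ∀ i ∈ (Finset.univ : Finset (Fin d)), ∫ x,
            (secondDiff (explicitPotential y g) (t • EuclideanSpace.single i (1 : ℝ)) x
            + secondDiff (explicitPotential y g') (t • EuclideanSpace.single i (1 : ℝ)) x
            + 4 * midpointGap y g g' x) / t ∂μ
            ≤ 2 * (M * (R * V)) * t + 2 * (semidual μ b y g - semidual μ b y g') / t := by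
          intro i _
          rw [integral_div, integral_add ((hsd g i).fun_add (hsd g' i)) (hgi.const_mul 4),
            integral_add (hsd g i) (hsd g' i), integral_const_mul, div_le_iff₀ ht]
          have h1 := hsdle g i
          have h2 := hsdle g' i
          have h3 : (2 * (M * (R * V)) * t + 2 * (semidual μ b y g - semidual μ b y g') / t) * t
              = 2 * (M * (R * t ^ 2 * V)) + 2 * (semidual μ b y g - semidual μ b y g') := by
            field_simp
          rw [h3]
          linarith
        refine (Finset.sum_le_sum this).trans (le_of_eq ?_)
        rw [Finset.sum_const, Finset.card_univ, Fintype.card_fin, nsmul_eq_mul]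

end Euclidean

/-! ### Extended-valued integrals reduced to real ones. -/

section ExtIntegral

variable {E : Type*} [MeasurableSpace E]

theorem extIntegral_ne_bot {μ : Measure E} {φ : E → EReal}
    (h : ∫⁻ x, (-φ x).toENNReal ∂μ ≠ ⊤) : extIntegral μ φ ≠ ⊥ := by
  unfold extIntegral
  lift ∫⁻ x, (-φ x).toENNReal ∂μ to NNReal using h with r
  rw [sub_eq_add_neg, ne_eq, EReal.add_eq_bot_iff]
  simp

theorem lintegral_toENNReal_ne_top {μ : Measure E} {φ : E → EReal}
    (h : ∫⁻ x, (-φ x).toENNReal ∂μ ≠ ⊤) (h' : extIntegral μ φ ≠ ⊤) :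
    ∫⁻ x, (φ x).toENNReal ∂μ ≠ ⊤ := by
  contrapose! h'
  unfold extIntegral
  lift ∫⁻ x, (-φ x).toENNReal ∂μ to NNReal using h with r
  rw [h', EReal.coe_ennreal_top]
  exact EReal.top_sub_coe r

theorem extIntegral_congr_ae {μ : Measure E} {φ ψ : E → EReal} (h : φ =ᵐ[μ] ψ) :
    extIntegral μ φ = extIntegral μ ψ := by
  unfold extIntegral
  congr 2
  · exact lintegral_congr_ae (h.mono fun x hx => by simp only [hx])
  · exact lintegral_congr_ae (h.mono fun x hx => by simp only [hx])

theorem extIntegral_coe {μ : Measure E} {f : E → ℝ} (hf : Integrable f μ) :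
    extIntegral μ (fun x => (f x : EReal)) = ((∫ x, f x ∂μ : ℝ) : EReal) := by
  unfold extIntegral
  simp only [← EReal.coe_neg, EReal.real_coe_toENNReal]
  have h1 : ∫⁻ x, ENNReal.ofReal (f x) ∂μ ≠ ⊤ := hf.lintegral_lt_top.ne
  have h2 : ∫⁻ x, ENNReal.ofReal (-f x) ∂μ ≠ ⊤ := hf.neg.lintegral_lt_top.ne
  rw [integral_eq_lintegral_pos_part_sub_lintegral_neg_part hf, EReal.coe_sub,
    EReal.coe_ennreal_toReal h1, EReal.coe_ennreal_toReal h2]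

theorem integrable_toReal_of_extIntegral_ne_top {μ : Measure E} {φ : E → EReal}
    (hφ : Measurable φ) (h : ∫⁻ x, (-φ x).toENNReal ∂μ ≠ ⊤) (h' : extIntegral μ φ ≠ ⊤) :
    Integrable (fun x => (φ x).toReal) μ ∧ ∀ᵐ x ∂μ, φ x = ((φ x).toReal : EReal) := by
  have h1 := lintegral_toENNReal_ne_top h h'
  have m1 : Measurable fun x => (φ x).toENNReal := hφ.ereal_toENNReal
  have m2 : Measurable fun x => (-φ x).toENNReal := hφ.neg.ereal_toENNReal
  have hfin : ∀ᵐ x ∂μ, φ x = ((φ x).toReal : EReal) := by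
    filter_upwards [ae_lt_top m1 h1, ae_lt_top m2 h] with x h1 h2
    refine (EReal.coe_toReal ?_ ?_).symm
    · exact EReal.toENNReal_ne_top_iff.1 h1.ne
    · intro h3
      rw [h3] at h2
      simp at h2
  refine ⟨⟨hφ.ereal_toReal.aestronglyMeasurable, ?_⟩, hfin⟩
  have : ∫⁻ x, ‖(φ x).toReal‖ₑ ∂μ ≤ ∫⁻ x, ((φ x).toENNReal + (-φ x).toENNReal) ∂μ := by
    refine lintegral_mono_ae ?_
    filter_upwards [hfin] with x hx
    generalize (φ x).toReal = r at hx
    rw [hx, ← EReal.coe_neg, EReal.real_coe_toENNReal, EReal.real_coe_toENNReal,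
      Real.enorm_eq_ofReal_abs]
    rcases le_total 0 r with hr | hr
    · rw [abs_of_nonneg hr]
      exact le_self_add
    · rw [abs_of_nonpos hr]
      exact le_add_self
  refine this.trans_lt ?_
  rw [lintegral_add_left m1]
  exact ENNReal.add_lt_top.2 ⟨h1.lt_top, h.lt_top⟩

variable [MeasurableSingletonClass E] {m : ℕ}

theorem lintegral_discreteMeasure (b : Fin m → ℝ) (y : Fin m → E) (f : E → ℝ≥0∞) :
    ∫⁻ x, f x ∂(discreteMeasure b y) = ∑ j, ENNReal.ofReal (b j) * f (y j) := by
  simp [discreteMeasure, lintegral_finsetSum_measure]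

theorem extIntegral_discreteMeasure {b : Fin m → ℝ} (hb : ∀ j, 0 ≤ b j) {y : Fin m → E}
    {φ : E → EReal} {c : Fin m → ℝ} (h : ∀ j, φ (y j) = c j) :
    extIntegral (discreteMeasure b y) φ = ((∑ j, b j * c j : ℝ) : EReal) := by
  have key : ∀ c : Fin m → ℝ, ((∑ j, ENNReal.ofReal (b j) * ENNReal.ofReal (c j) : ℝ≥0∞) : EReal)
      = ((∑ j, b j * max (c j) 0 : ℝ) : EReal) := fun c => by
    have h0 : ∀ j ∈ Finset.univ, 0 ≤ b j * max (c j) 0 := fun j _ =>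
      mul_nonneg (hb j) (le_max_right _ _)
    have : ∑ j, ENNReal.ofReal (b j) * ENNReal.ofReal (c j)
        = ENNReal.ofReal (∑ j, b j * max (c j) 0) := by
      rw [ENNReal.ofReal_sum_of_nonneg h0]
      refine Finset.sum_congr rfl fun j _ => ?_
      rw [ENNReal.ofReal_mul (hb j), ENNReal.ofReal_max, ENNReal.ofReal_zero, max_zero]
    rw [this, EReal.coe_ennreal_ofReal, max_eq_left (Finset.sum_nonneg h0)]
  unfold extIntegral
  rw [lintegral_discreteMeasure, lintegral_discreteMeasure]
  simp only [h, ← EReal.coe_neg, EReal.real_coe_toENNReal]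
  rw [key, key, ← EReal.coe_sub, ← Finset.sum_sub_distrib]
  congr 1
  refine Finset.sum_congr rfl fun j _ => ?_
  rw [← mul_sub, max_zero_sub_max_neg_zero_eq_self]

end ExtIntegral

/-! ### Brenier potentials for a discrete target: reduction to weights, and differentiability. -/

section Brenier

theorem fenchelConj_ne_bot {E : Type*} [NormedAddCommGroup E] [InnerProductSpace ℝ E]
    {φ : E → EReal} (hφ : ∃ x, φ x ≠ ⊤) (y : E) : fenchelConj φ y ≠ ⊥ := by
  obtain ⟨x, hx⟩ := hφ
  have h := le_iSup (fun x : E => ((⟪x, y⟫ : ℝ) : EReal) - φ x) x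
  intro hb
  unfold fenchelConj at hb
  rw [hb, le_bot_iff, sub_eq_add_neg, EReal.add_eq_bot_iff] at h
  simp [hx] at h

/-- A lower semicontinuous function attains its minimum on the compact ball, which bounds the
negative part there. -/
theorem lintegral_toENNReal_neg_ne_top {E : Type*} [NormedAddCommGroup E] [InnerProductSpace ℝ E]
    [ProperSpace E] [MeasurableSpace E] {μ : Measure E} [IsFiniteMeasure μ] {R : ℝ} (hR : 0 ≤ R)
    (hball : ∀ᵐ x ∂μ, x ∈ Metric.ball (0 : E) R) {φ : E → EReal} (hφ : IsGammaZero φ) :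
    ∫⁻ x, (-φ x).toENNReal ∂μ ≠ ⊤ := by
  obtain ⟨a, -, ha⟩ := LowerSemicontinuousOn.exists_isMinOn
    (⟨0, Metric.mem_closedBall_self hR⟩ : (Metric.closedBall (0 : E) R).Nonempty)
    (isCompact_closedBall _ _) (hφ.lowerSemicontinuous.lowerSemicontinuousOn _)
  have h1 : (-φ a).toENNReal ≠ ⊤ := by
    rw [EReal.toENNReal_ne_top_iff, ne_eq, EReal.neg_eq_top_iff]
    exact hφ.ne_bot a
  have h2 : ∫⁻ x, (-φ x).toENNReal ∂μ ≤ ∫⁻ _, (-φ a).toENNReal ∂μ := by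
    refine lintegral_mono_ae ?_
    filter_upwards [hball] with x hx
    exact EReal.toENNReal_le_toENNReal
      (EReal.neg_le_neg_iff.2 (ha (Metric.ball_subset_closedBall hx)))
  refine (h2.trans_lt ?_).ne
  rw [lintegral_const]
  exact ENNReal.mul_lt_top h1.lt_top (measure_lt_top _ _)

variable {d m : ℕ}

local notation "𝔼" => EuclideanSpace ℝ (Fin d)

/-- Only an inequality: if piece `j` is nowhere active, the conjugate at `y j` can be strictly below
`‖y j‖ ^ 2 / 2 - g j`. -/
theorem dualObjective_explicitPotential_le [NeZero m] {μ : Measure 𝔼} [IsFiniteMeasure μ] {R : ℝ}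
    (hball : ∀ᵐ x ∂μ, x ∈ Metric.ball (0 : 𝔼) R) {b : Fin m → ℝ} (hb : ∀ j, 0 ≤ b j)
    (y : Fin m → 𝔼) (g : Fin m → ℝ) :
    dualObjective μ (discreteMeasure b y) (fun x => (explicitPotential y g x : EReal))
      ≤ (semidual μ b y g : EReal) := by
  set ψ : 𝔼 → EReal := fun x => (explicitPotential y g x : EReal) with hψ
  have h1 : ∀ j, fenchelConj ψ (y j) = ((fenchelConj ψ (y j)).toReal : EReal) := fun j =>
    (EReal.coe_toReal ((fenchelConj_explicitPotential_le y g j).trans_lt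
      (EReal.coe_lt_top _)).ne (fenchelConj_ne_bot (φ := ψ) ⟨0, EReal.coe_ne_top _⟩ _)).symm
  unfold dualObjective semidual
  rw [extIntegral_coe (integrable_of_continuous hball (continuous_explicitPotential y g)),
    extIntegral_discreteMeasure hb h1, ← EReal.coe_add, EReal.coe_le_coe_iff]
  refine add_le_add le_rfl (Finset.sum_le_sum fun j _ => mul_le_mul_of_nonneg_left ?_ (hb j))
  rw [← EReal.coe_le_coe_iff, ← h1]
  exact fenchelConj_explicitPotential_le y g j

/-- A Brenier potential for a discrete target agrees almost everywhere with an explicit potential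
that lies below it and minimizes the semi-dual objective. -/
theorem exists_explicitPotential_of_isBrenierPotential [NeZero m] {μ : Measure 𝔼}
    [IsFiniteMeasure μ] {R : ℝ} (hR : 0 ≤ R) (hball : ∀ᵐ x ∂μ, x ∈ Metric.ball (0 : 𝔼) R)
    {b : Fin m → ℝ} (hb : ∀ j, 0 < b j) {y : Fin m → 𝔼} {φ : 𝔼 → EReal}
    (hφ : IsBrenierPotential μ (discreteMeasure b y) φ) :
    ∃ g : Fin m → ℝ, (∀ h, semidual μ b y g ≤ semidual μ b y h) ∧
      (∀ x, (explicitPotential y g x : EReal) ≤ φ x) ∧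
      ∀ᵐ x ∂μ, φ x = (explicitPotential y g x : EReal) := by
  obtain ⟨hΓ, hopt⟩ := hφ
  have hb0 : ∀ j, 0 ≤ b j := fun j => (hb j).le
  have hle : ∀ g, dualObjective μ (discreteMeasure b y) φ ≤ (semidual μ b y g : EReal) := fun g =>
    (hopt _ (isGammaZero_explicitPotential y g)).trans
      (dualObjective_explicitPotential_le hball hb0 y g)
  have n1 : ∫⁻ x, (-φ x).toENNReal ∂μ ≠ ⊤ := lintegral_toENNReal_neg_ne_top hR hball hΓ
  have n2 : ∫⁻ x, (-fenchelConj φ x).toENNReal ∂(discreteMeasure b y) ≠ ⊤ := by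
    rw [lintegral_discreteMeasure]
    refine ENNReal.sum_ne_top.2 fun j _ => ENNReal.mul_ne_top ENNReal.ofReal_ne_top ?_
    rw [EReal.toENNReal_ne_top_iff, ne_eq, EReal.neg_eq_top_iff]
    exact fenchelConj_ne_bot hΓ.exists_ne_top _
  -- In `EReal` the sum `⊤ + ⊥` is `⊥`, so finiteness of each integral follows from finiteness of
  -- the sum only once `⊥` is excluded.
  have b1 := extIntegral_ne_bot n1
  have b2 := extIntegral_ne_bot n2
  have hsum : extIntegral μ φ + extIntegral (discreteMeasure b y) (fenchelConj φ) ≠ ⊤ :=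
    ((hle 0).trans_lt (EReal.coe_lt_top _)).ne
  have t1 : extIntegral μ φ ≠ ⊤ := fun h => hsum (by rw [h, EReal.top_add_of_ne_bot b2])
  have t2 : extIntegral (discreteMeasure b y) (fenchelConj φ) ≠ ⊤ := fun h =>
    hsum (by rw [h, EReal.add_top_of_ne_bot b1])
  obtain ⟨hφint, hae⟩ :=
    integrable_toReal_of_extIntegral_ne_top hΓ.lowerSemicontinuous.measurable n1 t1
  -- Each atom has positive mass, so an infinite value there would make the integral infinite.
  have t3 : ∀ j, fenchelConj φ (y j) ≠ ⊤ := fun j hj => by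
    have := lintegral_toENNReal_ne_top n2 t2
    rw [lintegral_discreteMeasure, ENNReal.sum_ne_top] at this
    refine this j (Finset.mem_univ j) ?_
    rw [hj, EReal.toENNReal_top, ENNReal.mul_top]
    simpa using hb j
  set h : Fin m → ℝ := fun j => (fenchelConj φ (y j)).toReal with hh
  have hh' : ∀ j, fenchelConj φ (y j) = (h j : EReal) := fun j =>
    (EReal.coe_toReal (t3 j) (fenchelConj_ne_bot hΓ.exists_ne_top _)).symm
  -- With these weights piece `k` is `x ↦ ⟪x, y k⟫ - φ*(y k)`, which lies below `φ` by
  -- Fenchel–Young.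
  set g : Fin m → ℝ := fun j => 1 / 2 * ‖y j‖ ^ 2 - h j with hg
  have hval : dualObjective μ (discreteMeasure b y) φ
      = ((∫ x, (φ x).toReal ∂μ + ∑ j, b j * h j : ℝ) : EReal) := by
    unfold dualObjective
    rw [extIntegral_congr_ae hae, extIntegral_coe hφint, extIntegral_discreteMeasure hb0 hh',
      EReal.coe_add]
  have hbelow : ∀ x, (explicitPotential y g x : EReal) ≤ φ x := fun x => by
    obtain ⟨k, hk⟩ := exists_affinePiece_eq_explicitPotential y g x
    have h1 := le_iSup (fun x : 𝔼 => ((⟪x, y k⟫ : ℝ) : EReal) - φ x) x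
    have h2 : ((⟪x, y k⟫ : ℝ) : EReal) - φ x ≤ (h k : EReal) := h1.trans_eq (hh' k)
    rw [← hk]
    unfold affinePiece
    have hb := hΓ.ne_bot x
    induction hx : φ x with
    | bot => exact absurd hx hb
    | top => exact le_top
    | coe r =>
      rw [hx, ← EReal.coe_sub, EReal.coe_le_coe_iff] at h2
      rw [EReal.coe_le_coe_iff, hg]
      linarith
  have hsd : semidual μ b y g = ∫ x, explicitPotential y g x ∂μ + ∑ j, b j * h j := by
    unfold semidual
    congr 1
    refine Finset.sum_congr rfl fun j _ => ?_
    rw [hg]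
    ring
  have hgi : Integrable (explicitPotential y g) μ :=
    integrable_of_continuous hball (continuous_explicitPotential y g)
  have hpt : ∀ᵐ x ∂μ, explicitPotential y g x ≤ (φ x).toReal := by
    filter_upwards [hae] with x hx
    rw [← EReal.coe_le_coe_iff, ← hx]
    exact hbelow x
  have i1 : ∫ x, explicitPotential y g x ∂μ ≤ ∫ x, (φ x).toReal ∂μ :=
    integral_mono_ae hgi hφint hpt
  have i2 : ∀ g', ∫ x, (φ x).toReal ∂μ + ∑ j, b j * h j ≤ semidual μ b y g' := fun g' => by
    have := hle g'
    rwa [hval, EReal.coe_le_coe_iff] at this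
  refine ⟨g, fun g' => ?_, hbelow, ?_⟩
  · have := i2 g'
    linarith
  · have i3 := i2 g
    have i4 : ∫ x, ((φ x).toReal - explicitPotential y g x) ∂μ = 0 := by
      rw [integral_sub hφint hgi]
      linarith
    rw [integral_eq_zero_iff_of_nonneg_ae (hpt.mono fun x hx => sub_nonneg.2 hx)
      (hφint.sub hgi)] at i4
    filter_upwards [i4, hae] with x h1 h2
    rw [h2, sub_eq_zero.1 h1]

theorem convex_ne_top {E : Type*} [NormedAddCommGroup E] [InnerProductSpace ℝ E] {φ : E → EReal}
    (hφ : IsGammaZero φ) : Convex ℝ {x | φ x ≠ ⊤} := by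
  intro x hx z hz a b ha hb hab
  have h := hφ.convex_epigraph (x := (x, (φ x).toReal)) (EReal.le_coe_toReal hx)
    (y := (z, (φ z).toReal)) (EReal.le_coe_toReal hz) ha hb hab
  exact (lt_of_le_of_lt h (EReal.coe_lt_top _)).ne

theorem convexOn_toReal {E : Type*} [NormedAddCommGroup E] [InnerProductSpace ℝ E] {φ : E → EReal}
    (hφ : IsGammaZero φ) : ConvexOn ℝ {x | φ x ≠ ⊤} fun x => (φ x).toReal := by
  refine ⟨convex_ne_top hφ, fun x hx z hz a b ha hb hab => ?_⟩
  have h := hφ.convex_epigraph (x := (x, (φ x).toReal)) (EReal.le_coe_toReal hx)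
    (y := (z, (φ z).toReal)) (EReal.le_coe_toReal hz) ha hb hab
  exact EReal.toReal_le_toReal h (hφ.ne_bot _) (EReal.coe_ne_top _)

/-- A finite convex function on an open set is differentiable almost everywhere there. -/
theorem ae_differentiableAt_of_convexOn {s : Set 𝔼} (hs : IsOpen s) {f : 𝔼 → ℝ}
    (hf : ConvexOn ℝ s f) : ∀ᵐ x, x ∈ s → DifferentiableAt ℝ f x := by
  have hloc := hf.locallyLipschitzOn hs
  rw [ae_iff]
  refine measure_null_of_locally_null _ fun x hx => ?_
  have hxs : x ∈ s := by
    by_contra h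
    exact hx fun h' => absurd h' h
  obtain ⟨K, t, ht, hK⟩ := hloc hxs
  rw [hs.nhdsWithin_eq hxs] at ht
  refine ⟨{x | ¬(x ∈ s → DifferentiableAt ℝ f x)} ∩ interior t,
    inter_mem_nhdsWithin _ (interior_mem_nhds.2 ht), ?_⟩
  -- Rademacher's theorem on a neighbourhood where `f` is Lipschitz.
  have := (hK.mono interior_subset).ae_differentiableWithinAt_of_mem (μ := volume)
  rw [ae_iff] at this
  refine measure_mono_null (fun z hz => ?_) this
  intro h
  exact hz.1 fun _ => (h hz.2).differentiableAt (isOpen_interior.mem_nhds hz.2)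

/-- The domain is convex, so its frontier is Lebesgue-null; almost every point of it is thus
interior, where a finite convex function is differentiable almost everywhere. -/
theorem ae_isDifferentiableAt {μ : Measure 𝔼} (hμ : μ ≪ volume) {φ : 𝔼 → EReal}
    (hφ : IsGammaZero φ) (hfin : ∀ᵐ x ∂μ, φ x ≠ ⊤) : ∀ᵐ x ∂μ, IsDifferentiableAt φ x := by
  have hc := convexOn_toReal hφ
  have h1 : ∀ᵐ x : 𝔼, x ∉ frontier {x | φ x ≠ ⊤} :=
    measure_eq_zero_iff_ae_notMem.1 (hc.1.addHaar_frontier volume)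
  have h2 := ae_differentiableAt_of_convexOn isOpen_interior
    (hc.subset interior_subset hc.1.interior)
  filter_upwards [hμ.ae_le h1, hμ.ae_le h2, hfin] with x h1 h2 h3
  have h4 : x ∈ interior {x | φ x ≠ ⊤} := by
    by_contra h
    exact h1 ⟨subset_closure h3, h⟩
  refine ⟨?_, h2 h4⟩
  filter_upwards [isOpen_interior.mem_nhds h4] with z hz
  exact ⟨hφ.ne_bot z, interior_subset hz⟩

/-- If `φ` touches from above a function with subgradient `v` at a point where `φ` is
differentiable, then `v` is the gradient of `φ` there. -/
theorem grad_eq_of_mem_subdifferential {φ : 𝔼 → EReal} {ψ : 𝔼 → ℝ} {x v : 𝔼}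
    (hφ : IsDifferentiableAt φ x) (hle : ∀ z, (ψ z : EReal) ≤ φ z) (heq : φ x = ψ x)
    (hv : v ∈ subdifferential ψ x) : grad φ x = v := by
  obtain ⟨hfin, hdiff⟩ := hφ
  have hgrad : HasGradientAt (fun z => (φ z).toReal - ⟪v, z⟫) (grad φ x - v) x := by
    have h1 : HasGradientAt (fun z => (φ z).toReal) (grad φ x) x := hdiff.hasGradientAt
    rw [hasGradientAt_iff_hasFDerivAt] at h1 ⊢
    rw [map_sub]
    exact h1.sub (InnerProductSpace.toDual ℝ 𝔼 v).hasFDerivAt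
  have hmin : IsLocalMin (fun z => (φ z).toReal - ⟪v, z⟫) x := by
    filter_upwards [hfin] with z hz
    have h1 : ψ z ≤ (φ z).toReal := by
      rw [← EReal.coe_le_coe_iff, EReal.coe_toReal hz.2 hz.1]
      exact hle z
    have h2 := hv z
    rw [inner_sub_right] at h2
    rw [heq, EReal.toReal_coe]
    linarith
  have := hmin.hasFDerivAt_eq_zero hgrad.hasFDerivAt
  rw [map_eq_zero_iff _ (InnerProductSpace.toDual ℝ 𝔼).injective] at this
  exact sub_eq_zero.1 this

end Brenier

/-! ### Optimal weights of the discrete linear program. -/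

section DiscreteDual

variable {E : Type*} [NormedAddCommGroup E] [InnerProductSpace ℝ E] {n m : ℕ}

theorem half_norm_sub_sq (x : E) (y : Fin m → E) (g : Fin m → ℝ) (j : Fin m) :
    1 / 2 * ‖x - y j‖ ^ 2 = 1 / 2 * ‖x‖ ^ 2 - affinePiece y g j x + g j := by
  rw [norm_sub_sq_real, affinePiece]
  ring

/-- Optimal dual weights oscillate by at most the oscillation of the cost. -/
theorem IsDualOptimal.sub_le {E : Type*} [NormedAddCommGroup E] {n m : ℕ} [NeZero n]
    {a : Fin n → ℝ} {b : Fin m → ℝ} {x : Fin n → E} {y : Fin m → E}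
    {f : Fin n → ℝ} {g : Fin m → ℝ} (h : IsDualOptimal a x b y f g) (hb : ∀ j, 0 < b j) {R : ℝ}
    (hx : ∀ i, ‖x i‖ ≤ R) (hy : ∀ j, ‖y j‖ ≤ R) (j k : Fin m) : g k - g j ≤ 2 * R ^ 2 := by
  obtain ⟨hf, hopt⟩ := h
  -- Some constraint involving `j` is tight: otherwise `g j` could be raised by the least slack,
  -- improving the objective because `b j > 0`.
  have tight : ∃ i, 1 / 2 * ‖x i - y j‖ ^ 2 ≤ f i + g j := by
    by_contra! hlt
    obtain ⟨i₀, hi₀⟩ := Finite.exists_min fun i => 1 / 2 * ‖x i - y j‖ ^ 2 - (f i + g j)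
    set η := 1 / 2 * ‖x i₀ - y j‖ ^ 2 - (f i₀ + g j) with hη
    have hη0 : 0 < η := sub_pos.2 (hlt i₀)
    have hfeas : IsDualFeasible x y f (Function.update g j (g j + η)) := fun i l => by
      rcases eq_or_ne l j with rfl | hl
      · have := hi₀ i
        rw [Function.update_self]
        linarith
      · rw [Function.update_of_ne hl]
        exact hf i l
    have h1 := hopt _ _ hfeas
    have h2 : ∑ l, Function.update g j (g j + η) l * b l = ∑ l, g l * b l + η * b j := by
      rw [← Finset.add_sum_erase _ _ (Finset.mem_univ j),
        ← Finset.add_sum_erase _ (fun l => g l * b l) (Finset.mem_univ j), Function.update_self]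
      have : ∑ l ∈ Finset.univ.erase j, Function.update g j (g j + η) l * b l
          = ∑ l ∈ Finset.univ.erase j, g l * b l :=
        Finset.sum_congr rfl fun l hl => by
          rw [Function.update_of_ne (Finset.ne_of_mem_erase hl)]
      rw [this]
      ring
    have h3 := mul_pos hη0 (hb j)
    linarith
  obtain ⟨i, hi⟩ := tight
  have h1 := hf i k
  have h2 : ‖x i - y k‖ ^ 2 ≤ (R + R) ^ 2 :=
    pow_le_pow_left₀ (norm_nonneg _) ((norm_sub_le _ _).trans (add_le_add (hx i) (hy k))) 2
  have h3 := sq_nonneg ‖x i - y j‖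
  nlinarith

/-- Optimal dual weights minimize the semi-dual objective of the discrete source. -/
theorem IsDualOptimal.semidual_le [NeZero m] {a : Fin n → ℝ} (ha : ∀ i, 0 ≤ a i) {b : Fin m → ℝ}
    {x : Fin n → E} {y : Fin m → E} {f : Fin n → ℝ} {g : Fin m → ℝ}
    (h : IsDualOptimal a x b y f g) (g' : Fin m → ℝ) :
    ∑ i, explicitPotential y g (x i) * a i - ∑ j, g j * b j
      ≤ ∑ i, explicitPotential y g' (x i) * a i - ∑ j, g' j * b j := by
  obtain ⟨hf, hopt⟩ := h
  -- The competitor's first component is the c-transform of `g'`, the largest one feasible with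
  -- `g'`.
  have h1 := hopt (fun i => 1 / 2 * ‖x i‖ ^ 2 - explicitPotential y g' (x i)) g' fun i j => by
    rw [half_norm_sub_sq (x i) y g' j]
    have := affinePiece_le_explicitPotential y g' j (x i)
    linarith
  have h2 : ∑ i, f i * a i ≤ ∑ i, (1 / 2 * ‖x i‖ ^ 2 - explicitPotential y g (x i)) * a i := by
    refine Finset.sum_le_sum fun i _ => mul_le_mul_of_nonneg_right ?_ (ha i)
    obtain ⟨k, hk⟩ := exists_affinePiece_eq_explicitPotential y g (x i)
    have := hf i k
    rw [half_norm_sub_sq (x i) y g k] at this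
    linarith
  simp only [sub_mul, Finset.sum_sub_distrib] at h1 h2
  linarith

end DiscreteDual

/-! ### Uniform control of the empirical deviation. -/

section Deviation

variable {d m n : ℕ}

local notation "𝔼" => EuclideanSpace ℝ (Fin d)

/-- The deviation `∫ φ_g dμ - (1 / n) ∑ i, φ_g (x i)`. -/
def deviation (μ : Measure 𝔼) (y : Fin m → 𝔼) (x : Fin n → 𝔼) (g : Fin m → ℝ) : ℝ :=
  ∫ z, explicitPotential y g z ∂μ - ∑ i, explicitPotential y g (x i) * (1 / (n : ℝ))

/-- A common shift `c` of the weights cancels, since both measures have mass one. Weights therefore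
need to be approximated only modulo constants, and rounding downwards costs `ε` only in the integral
against `μ`. -/
theorem deviation_le_add [NeZero m] [NeZero n] {μ : Measure 𝔼} [IsProbabilityMeasure μ] {R : ℝ}
    (hball : ∀ᵐ x ∂μ, x ∈ Metric.ball (0 : 𝔼) R) (y : Fin m → 𝔼) (x : Fin n → 𝔼)
    {g q : Fin m → ℝ} {ε : ℝ} (c : ℝ) (h1 : ∀ j, q j + c ≤ g j) (h2 : ∀ j, g j ≤ q j + c + ε) :
    deviation μ y x g ≤ deviation μ y x q + ε := by
  have hn : (n : ℝ) ≠ 0 := Nat.cast_ne_zero.2 (NeZero.ne n)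
  have hφint : ∀ g, Integrable (explicitPotential y g) μ := fun g =>
    integrable_of_continuous hball (continuous_explicitPotential y g)
  have e1 : ∫ z, explicitPotential y g z ∂μ ≤ ∫ z, explicitPotential y q z ∂μ + (c + ε) := by
    have : ∫ z, explicitPotential y g z ∂μ ≤ ∫ z, (explicitPotential y q z + (c + ε)) ∂μ :=
      integral_mono (hφint g) ((hφint q).add (integrable_const _)) fun z =>
        explicitPotential_le_of_le y (fun j => by linarith [h2 j]) z
    rwa [integral_add (hφint q) (integrable_const _), integral_const, probReal_univ, one_smul]
      at this
  have e2 : ∑ i, (explicitPotential y q (x i) + c) * (1 / (n : ℝ))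
      ≤ ∑ i, explicitPotential y g (x i) * (1 / (n : ℝ)) := by
    refine Finset.sum_le_sum fun i _ => mul_le_mul_of_nonneg_right ?_ (by positivity)
    have := explicitPotential_le_of_le y (g := q) (g' := g) (ε := -c)
      (fun j => by linarith [h1 j]) (x i)
    linarith
  have e3 : ∑ i : Fin n, (explicitPotential y q (x i) + c) * (1 / (n : ℝ))
      = ∑ i, explicitPotential y q (x i) * (1 / (n : ℝ)) + c := by
    simp only [add_mul, Finset.sum_add_distrib, Finset.sum_const, Finset.card_univ,
      Fintype.card_fin, nsmul_eq_mul]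
    field_simp
  unfold deviation
  linarith

theorem semidual_sub_le_deviation [NeZero m] {μ : Measure 𝔼} {b : Fin m → ℝ} {x : Fin n → 𝔼}
    {y : Fin m → 𝔼} {f : Fin n → ℝ} {g : Fin m → ℝ}
    (h : IsDualOptimal (fun _ => 1 / (n : ℝ)) x b y f g) (g' : Fin m → ℝ) :
    semidual μ b y g - semidual μ b y g' ≤ deviation μ y x g - deviation μ y x g' := by
  have h1 := h.semidual_le (fun _ => by positivity) g'
  have h2 : ∀ g : Fin m → ℝ, ∑ j, b j * (1 / 2 * ‖y j‖ ^ 2 - g j)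
      = ∑ j, b j * (1 / 2 * ‖y j‖ ^ 2) - ∑ j, g j * b j := fun g => by
    simp only [mul_sub, Finset.sum_sub_distrib]
    congr 1
    exact Finset.sum_congr rfl fun j _ => mul_comm _ _
  unfold semidual deviation
  rw [h2, h2]
  linarith

theorem integral_explicitPotential_comp [NeZero m] {Ω : Type*} [MeasurableSpace Ω] {P : Measure Ω}
    {X : Ω → 𝔼} {μ : Measure 𝔼} (hX : HasLaw X μ P)
    (y : Fin m → 𝔼) (g : Fin m → ℝ) :
    ∫ ω, explicitPotential y g (X ω) ∂P = ∫ z, explicitPotential y g z ∂μ :=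
  hX.integral_comp (continuous_explicitPotential y g).aestronglyMeasurable

variable {Ω : Type*} [MeasurableSpace Ω] {P : Measure Ω} [IsProbabilityMeasure P]
  {X : Fin n → Ω → EuclideanSpace ℝ (Fin d)} {μ : Measure (EuclideanSpace ℝ (Fin d))}

theorem integrable_deviation [IsProbabilityMeasure μ] [NeZero m] {R : ℝ}
    (hball : ∀ᵐ x ∂μ, x ∈ Metric.ball (0 : 𝔼) R)
    (hX : ∀ i, HasLaw (X i) μ P) (y : Fin m → 𝔼) (g : Fin m → ℝ) :
    Integrable (fun ω => deviation μ y (fun i => X i ω) g) P := by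
  have hφint : Integrable (explicitPotential y g) μ :=
    integrable_of_continuous hball (continuous_explicitPotential y g)
  refine (integrable_const _).sub (integrable_finsetSum _ fun i _ => Integrable.mul_const ?_ _)
  rw [← (hX i).map_eq] at hφint
  exact hφint.comp_aemeasurable (hX i).aemeasurable

theorem integral_deviation [IsProbabilityMeasure μ] [NeZero m] [NeZero n] {R : ℝ}
    (hball : ∀ᵐ x ∂μ, x ∈ Metric.ball (0 : 𝔼) R)
    (hX : ∀ i, HasLaw (X i) μ P) (y : Fin m → 𝔼) (g : Fin m → ℝ) :
    ∫ ω, deviation μ y (fun i => X i ω) g ∂P = 0 := by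
  have hn : (n : ℝ) ≠ 0 := Nat.cast_ne_zero.2 (NeZero.ne n)
  have hφint : Integrable (explicitPotential y g) μ :=
    integrable_of_continuous hball (continuous_explicitPotential y g)
  have hi : ∀ i ∈ Finset.univ,
      Integrable (fun ω => explicitPotential y g (X i ω) * (1 / (n : ℝ))) P := fun i _ => by
    rw [← (hX i).map_eq] at hφint
    exact (hφint.comp_aemeasurable (hX i).aemeasurable).mul_const _
  unfold deviation
  rw [integral_sub (integrable_const _) (integrable_finsetSum _ hi), integral_finsetSum _ hi]
  simp only [integral_mul_const, integral_explicitPotential_comp (hX _), integral_const,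
    probReal_univ, one_smul, Finset.sum_const, Finset.card_univ, Fintype.card_fin, nsmul_eq_mul]
  field_simp
  ring

/-- Hoeffding's lemma: the values lie in `[-H, H]`, so each centred term is sub-Gaussian with
variance proxy `H ^ 2`. Summing `n` independent terms scaled by `l / n` gives the exponent. -/
theorem integral_exp_deviation_le [NeZero m] [NeZero n] {R B : ℝ}
    (hball : ∀ᵐ x ∂μ, x ∈ Metric.ball (0 : 𝔼) R) (hX : ∀ i, HasLaw (X i) μ P)
    (hind : iIndepFun X P) {y : Fin m → 𝔼} (hy : ∀ j, ‖y j‖ ≤ R) {q : Fin m → ℝ}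
    (hq : ∀ j, |q j| ≤ B) (l : ℝ) :
    Integrable (fun ω => Real.exp (l * deviation μ y (fun i => X i ω) q)) P ∧
    ∫ ω, Real.exp (l * deviation μ y (fun i => X i ω) q) ∂P
      ≤ Real.exp ((3 / 2 * R ^ 2 + B) ^ 2 * l ^ 2 / (2 * n)) := by
  have hn : (n : ℝ) ≠ 0 := Nat.cast_ne_zero.2 (NeZero.ne n)
  set H := 3 / 2 * R ^ 2 + B with hH
  have hB : 0 ≤ B := (abs_nonneg _).trans (hq 0)
  have hH0 : 0 ≤ H := by positivity
  have hcont := continuous_explicitPotential y q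
  have hsub : ∀ i ∈ Finset.univ, HasSubgaussianMGF
      (fun ω => explicitPotential y q (X i ω) - ∫ z, explicitPotential y q z ∂μ)
      ((‖H - -H‖₊ / 2) ^ 2) P := fun i _ => by
    have hb : ∀ᵐ ω ∂P, explicitPotential y q (X i ω) ∈ Set.Icc (-H) H := by
      have h1 : ∀ᵐ ω ∂P, X i ω ∈ Metric.ball (0 : 𝔼) R :=
        ae_of_ae_map (hX i).aemeasurable (by rw [(hX i).map_eq]; exact hball)
      filter_upwards [h1] with ω hω
      rw [mem_ball_zero_iff] at hω
      exact abs_le.1 (abs_explicitPotential_le hy hq hω.le)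
    have := hasSubgaussianMGF_of_mem_Icc
      (hcont.measurable.comp_aemeasurable (hX i).aemeasurable) hb
    simpa only [Function.comp_apply, integral_explicitPotential_comp (hX i)] using this
  have hind' : iIndepFun
      (fun i ω => explicitPotential y q (X i ω) - ∫ z, explicitPotential y q z ∂μ) P :=
    hind.comp (fun _ z => explicitPotential y q z - ∫ z, explicitPotential y q z ∂μ)
      fun _ => hcont.measurable.sub_const _
  have hsum := HasSubgaussianMGF.sum_of_iIndepFun hind' hsub
  have hdev : ∀ ω, l * deviation μ y (fun i => X i ω) q = -(l / n) *
      ∑ i, (explicitPotential y q (X i ω) - ∫ z, explicitPotential y q z ∂μ) := fun ω => by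
    simp only [deviation, Finset.sum_sub_distrib, ← Finset.sum_mul, Finset.sum_const,
      Finset.card_univ, Fintype.card_fin, nsmul_eq_mul]
    field_simp
    ring
  simp only [hdev]
  refine ⟨hsum.integrable_exp_mul _, (hsum.mgf_le _).trans (le_of_eq ?_)⟩
  congr 1
  have hnorm : ‖H - -H‖ = 2 * H := by
    rw [sub_neg_eq_add, ← two_mul, Real.norm_of_nonneg (by positivity)]
  simp only [Finset.sum_const, Finset.card_univ, Fintype.card_fin, nsmul_eq_mul, NNReal.coe_mul,
    NNReal.coe_natCast, NNReal.coe_pow, NNReal.coe_div, coe_nnnorm, hnorm, NNReal.coe_ofNat]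
  field_simp

/-- The semi-dual suboptimality of the empirical weights is dominated by a random variable with
small expectation. -/
theorem exists_integrable_semidual_gap_bound [IsProbabilityMeasure μ] [NeZero m] [NeZero n] {R : ℝ}
    (hball : ∀ᵐ x ∂μ, x ∈ Metric.ball (0 : 𝔼) R) (hX : ∀ i, HasLaw (X i) μ P)
    (hind : iIndepFun X P) {b : Fin m → ℝ} (hb : ∀ j, 0 < b j) {y : Fin m → 𝔼}
    (hy : ∀ j, ‖y j‖ ≤ R) {g : Ω → Fin m → ℝ}
    (hg : ∀ᵐ ω ∂P, ∃ f, IsDualOptimal (fun _ => 1 / (n : ℝ)) (fun i => X i ω) b y f (g ω))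
    (g' : Fin m → ℝ) {ε l : ℝ} (hε : 0 < ε) (hε1 : ε ≤ 1) (hl : 0 < l) :
    ∃ U : Ω → ℝ, Integrable U P ∧
      (∀ᵐ ω ∂P, semidual μ b y (g ω) - semidual μ b y g' ≤ U ω) ∧
      ∫ ω, U ω ∂P ≤ ε + (m * (2 * (2 * R ^ 2 / ε + 1))
        + (3 / 2 * R ^ 2 + (2 * R ^ 2 + 1)) ^ 2 * l ^ 2 / (2 * n)) / l := by
  set H := 3 / 2 * R ^ 2 + (2 * R ^ 2 + 1) with hH
  set L : ℕ := ⌈2 * R ^ 2 / ε⌉₊ with hL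
  have hL1 : 2 * R ^ 2 / ε ≤ L := Nat.le_ceil _
  have hL2 : (L : ℝ) < 2 * R ^ 2 / ε + 1 := Nat.ceil_lt_add_one (by positivity)
  set G : Finset (Fin m → ℤ) := Fintype.piFinset fun _ => Finset.Icc (-(L : ℤ)) L with hG
  -- The crude bound `2 * L + 1 ≤ exp (2 * L)` replaces a logarithm by a power of `1 / ε`, which the
  -- final rate can absorb.
  have hcard : (G.card : ℝ) ≤ Real.exp (m * (2 * L)) := by
    have h1 : G.card = (2 * L + 1) ^ m := by
      rw [hG, Fintype.card_piFinset_const, Int.card_Icc]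
      congr 1
      omega
    rw [h1, Real.exp_nat_mul]
    push_cast
    exact pow_le_pow_left₀ (by positivity) (Real.add_one_le_exp _) m
  set a : ℝ := m * (2 * L) + H ^ 2 * l ^ 2 / (2 * n) with ha
  set Z : (Fin m → ℝ) → Ω → ℝ := fun q ω => deviation μ y (fun i => X i ω) q with hZ
  set pt : (Fin m → ℤ) → Fin m → ℝ := fun z j => ε * z j with hpt
  have hptB : ∀ z ∈ G, ∀ j, |pt z j| ≤ 2 * R ^ 2 + 1 := fun z hz j => by
    have h1 := Finset.mem_Icc.1 (Fintype.mem_piFinset.1 hz j)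
    have h2 : |(z j : ℝ)| ≤ L := by
      rw [abs_le]
      exact_mod_cast h1
    rw [hpt, abs_mul, abs_of_pos hε]
    calc ε * |(z j : ℝ)| ≤ ε * (2 * R ^ 2 / ε + 1) := by gcongr; linarith
      _ = 2 * R ^ 2 + ε := by field_simp
      _ ≤ _ := by linarith
  have hexp := fun z (hz : z ∈ G) => integral_exp_deviation_le hball hX hind hy (hptB z hz) l
  -- The shift `a` is the log-cardinality bound plus the Hoeffding exponent, so the normalized sum
  -- has expectation at most `1`.
  set S : Ω → ℝ := fun ω => ∑ z ∈ G, Real.exp (l * Z (pt z) ω) * Real.exp (-a) with hS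
  have hSi : Integrable S P := integrable_finsetSum _ fun z hz => (hexp z hz).1.mul_const _
  have hSle : ∫ ω, S ω ∂P ≤ 1 := by
    rw [hS, integral_finsetSum _ fun z hz => (hexp z hz).1.mul_const _]
    calc ∑ z ∈ G, ∫ ω, Real.exp (l * Z (pt z) ω) * Real.exp (-a) ∂P
        ≤ ∑ z ∈ G, Real.exp (H ^ 2 * l ^ 2 / (2 * n)) * Real.exp (-a) := by
          refine Finset.sum_le_sum fun z hz => ?_
          rw [integral_mul_const]
          exact mul_le_mul_of_nonneg_right (hexp z hz).2 (Real.exp_pos _).le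
      _ = G.card * (Real.exp (H ^ 2 * l ^ 2 / (2 * n)) * Real.exp (-a)) := by
          rw [Finset.sum_const, nsmul_eq_mul]
      _ ≤ Real.exp (m * (2 * L)) * (Real.exp (H ^ 2 * l ^ 2 / (2 * n)) * Real.exp (-a)) := by
          gcongr
      _ = 1 := by
          rw [← Real.exp_add, ← Real.exp_add, Real.exp_eq_one_iff, ha]
          ring
  have hg'i : Integrable (Z g') P := integrable_deviation hball hX y g'
  have hSa : Integrable (fun ω => (a + S ω - 1) / l) P :=
    (((integrable_const a).add hSi).sub (integrable_const 1)).div_const l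
  -- The term `Z g'` has mean zero, as `g'` is deterministic; the random weights enter only through
  -- the grid-wide bound `S`.
  refine ⟨fun ω => ε + (a + S ω - 1) / l - Z g' ω,
    ((integrable_const ε).add hSa).sub hg'i, ?_, ?_⟩
  · have hXb : ∀ᵐ ω ∂P, ∀ i, X i ω ∈ Metric.ball (0 : 𝔼) R := ae_all_iff.2 fun i =>
      ae_of_ae_map (hX i).aemeasurable (by rw [(hX i).map_eq]; exact hball)
    filter_upwards [hg, hXb] with ω ⟨f, hf⟩ hω
    have h1 := semidual_sub_le_deviation (μ := μ) hf g'
    have hosc := hf.sub_le hb (fun i => (mem_ball_zero_iff.1 (hω i)).le) hy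
    -- Subtracting `g ω 0` fixes the free constant; the oscillation bound `2 * R ^ 2` then places
    -- the rounded weights in the grid.
    set z : Fin m → ℤ := fun j => ⌊(g ω j - g ω 0) / ε⌋ with hz
    have hz1 : ∀ j, ε * z j ≤ g ω j - g ω 0 := fun j => by
      rw [mul_comm, ← le_div_iff₀ hε]
      exact Int.floor_le _
    have hz2 : ∀ j, g ω j - g ω 0 ≤ ε * z j + ε := fun j => by
      have : (g ω j - g ω 0) / ε ≤ z j + 1 := (Int.lt_floor_add_one _).le
      rw [div_le_iff₀ hε] at this
      linarith
    have hzG : z ∈ G := by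
      refine Fintype.mem_piFinset.2 fun j => Finset.mem_Icc.2 ⟨?_, ?_⟩
      · rw [hz, Int.le_floor, le_div_iff₀ hε]
        push_cast
        have := hosc j 0
        have := (div_le_iff₀ hε).1 hL1
        linarith
      · have h2 : (z j : ℝ) ≤ L := by
          refine le_trans ?_ hL1
          rw [le_div_iff₀ hε, mul_comm]
          exact (hz1 j).trans (hosc 0 j)
        exact_mod_cast h2
    have h2 : deviation μ y (fun i => X i ω) (g ω) ≤ Z (pt z) ω + ε :=
      deviation_le_add hball y _ (g ω 0) (fun j => by linarith [hz1 j])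
        (fun j => by linarith [hz2 j])
    have h3 : Z (pt z) ω ≤ (a + S ω - 1) / l := by
      rw [le_div_iff₀ hl]
      have e1 : Real.exp (l * Z (pt z) ω) * Real.exp (-a) ≤ S ω :=
        Finset.single_le_sum (f := fun z => Real.exp (l * Z (pt z) ω) * Real.exp (-a))
          (fun z _ => by positivity) hzG
      rw [← Real.exp_add] at e1
      -- From `1 + u ≤ exp u`: one summand of `S` already bounds `l * Z - a + 1`, so no logarithm of
      -- `S` is needed.
      have e2 := Real.add_one_le_exp (l * Z (pt z) ω + -a)
      linarith
    linarith
  · have e1 : ∫ ω, (ε + (a + S ω - 1) / l - Z g' ω) ∂P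
        = ε + (a + ∫ ω, S ω ∂P - 1) / l := by
      rw [integral_sub ((integrable_const ε).fun_add hSa) hg'i,
        integral_add (integrable_const ε) hSa, integral_div,
        integral_sub ((integrable_const a).fun_add hSi) (integrable_const 1),
        integral_add (integrable_const a) hSi, integral_deviation hball hX y g']
      simp
    rw [e1]
    have e2 : a + ∫ ω, S ω ∂P - 1
        ≤ m * (2 * (2 * R ^ 2 / ε + 1)) + H ^ 2 * l ^ 2 / (2 * n) := by
      have : (m : ℝ) * (2 * L) ≤ m * (2 * (2 * R ^ 2 / ε + 1)) := by gcongr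
      linarith
    gcongr

end Deviation

/-! ### Only finitely many dimensions are possible. -/

section Dimension

/-- Comparison with `(d / 2)!`, the quotient rounded down. Taking `d ≥ 2` puts the arguments of
`Real.Gamma` in `[2, ∞)`, where it is increasing. -/
theorem tendsto_pow_div_Gamma {c : ℝ} (hc : 0 ≤ c) :
    Tendsto (fun d : ℕ => c ^ d / Real.Gamma (d / 2 + 1)) atTop (𝓝 0) := by
  set a := max c 1 with ha
  have ha1 : 1 ≤ a := le_max_right _ _
  have hhalf : Tendsto (fun d : ℕ => d / 2) atTop atTop :=
    Nat.tendsto_div_const_atTop two_ne_zero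
  have h1 : Tendsto (fun d : ℕ => a * ((a ^ 2) ^ (d / 2) / (d / 2).factorial)) atTop (𝓝 0) := by
    have := ((FloorSemiring.tendsto_pow_div_factorial_atTop (a ^ 2)).comp hhalf).const_mul a
    rwa [mul_zero] at this
  refine squeeze_zero' (Eventually.of_forall fun d => ?_) ?_ h1
  · have : 0 < Real.Gamma (d / 2 + 1) := Real.Gamma_pos_of_pos (by positivity)
    positivity
  · filter_upwards [eventually_ge_atTop 2] with d hd
    have hk : 1 ≤ d / 2 := by omega
    have hk' : ((d / 2 : ℕ) : ℝ) ≤ d / 2 := Nat.cast_div_le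
    have hk1 : (1 : ℝ) ≤ ((d / 2 : ℕ) : ℝ) := by exact_mod_cast hk
    have hΓ : ((d / 2).factorial : ℝ) ≤ Real.Gamma (d / 2 + 1) := by
      rw [← Real.Gamma_nat_eq_factorial]
      refine Real.Gamma_strictMonoOn_Ici.monotoneOn ?_ ?_ (by linarith)
      · simp only [Set.mem_Ici]
        linarith
      · simp only [Set.mem_Ici]
        linarith
    have hp : c ^ d ≤ a * (a ^ 2) ^ (d / 2) :=
      calc c ^ d ≤ a ^ d := pow_le_pow_left₀ hc (le_max_left _ _) d
        _ ≤ a ^ (2 * (d / 2) + 1) := pow_le_pow_right₀ ha1 (by omega)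
        _ = a * (a ^ 2) ^ (d / 2) := by rw [pow_succ, pow_mul, mul_comm]
    rw [← mul_div_assoc]
    gcongr

/-- A probability measure on the ball of radius `R` with density at most `M` only exists in
finitely many dimensions. -/
theorem exists_dimension_bound (M : ℝ) {R : ℝ} (hR : 0 < R) :
    ∃ d₀ : ℕ, ∀ (d : ℕ) (μ : Measure (EuclideanSpace ℝ (Fin d))) [IsProbabilityMeasure μ],
      (∀ᵐ x ∂μ, x ∈ Metric.ball (0 : EuclideanSpace ℝ (Fin d)) R) →
      HasDensityBoundedBy μ M → d < d₀ := by
  have h := (tendsto_pow_div_Gamma (c := R * √Real.pi) (by positivity)).const_mul M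
  rw [mul_zero] at h
  obtain ⟨d₁, hd₁⟩ := eventually_atTop.1 (h.eventually_lt_const one_pos)
  -- Beyond `d₁`, `M` times the volume of the ball is below `1`, so no mass-one measure fits. The
  -- extra `1` excludes `d = 0`, for which the ball-volume formula does not apply.
  refine ⟨d₁ + 1, fun d μ _ hball hdens => ?_⟩
  by_contra! hd
  have : Nonempty (Fin d) := ⟨⟨0, by omega⟩⟩
  have h1 : μ Set.univ ≤ _ := le_smul_restrict_ball hball hdens Set.univ
  rw [measure_univ, Measure.smul_apply, Measure.restrict_apply MeasurableSet.univ, Set.univ_inter,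
    EuclideanSpace.volume_ball, Fintype.card_fin, smul_eq_mul, ← ENNReal.ofReal_pow hR.le,
    ← ENNReal.ofReal_mul (by positivity), ← ENNReal.ofReal_mul' (by
      have : 0 < Real.Gamma (d / 2 + 1) := Real.Gamma_pos_of_pos (by positivity)
      positivity), ENNReal.one_le_ofReal] at h1
  have h2 := hd₁ d (by omega)
  rw [mul_pow] at h2
  have h3 : M * (R ^ d * (√Real.pi ^ d / Real.Gamma (d / 2 + 1)))
      = M * (R ^ d * √Real.pi ^ d / Real.Gamma (d / 2 + 1)) := by ring
  linarith

end Dimension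

/-! ### Choice of parameters and the convergence rate. -/

section Rate

/-- The constant of the convergence rate in dimension `d`. -/
def rateConst (M R : ℝ) (d : ℕ) : ℝ :=
  d * (2 * (M * (R * volume.real (Metric.ball (0 : EuclideanSpace ℝ (Fin d)) (R + 2))))
    + 2 * (3 + 4 * R ^ 2 + (3 / 2 * R ^ 2 + (2 * R ^ 2 + 1)) ^ 2 / 2))

theorem rateConst_nonneg {M R : ℝ} (hM : 0 ≤ M) (hR : 0 ≤ R) (d : ℕ) : 0 ≤ rateConst M R d := by
  unfold rateConst
  positivity

variable {d m n : ℕ}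

local notation "𝔼" => EuclideanSpace ℝ (Fin d)

variable {Ω : Type*} [MeasurableSpace Ω] {P : Measure Ω} [IsProbabilityMeasure P]
  {X : Fin n → Ω → EuclideanSpace ℝ (Fin d)} {μ : Measure (EuclideanSpace ℝ (Fin d))}
  [IsProbabilityMeasure μ]

/-- The trivial bound, sufficient when `m ≥ n`: all subgradients have norm at most `R`. -/
theorem lintegral_enorm_sub_le_two_mul [NeZero m] {R : ℝ} {y : Fin m → 𝔼}
    (hy : ∀ j, ‖y j‖ ≤ R) {g' : Fin m → ℝ} {w : 𝔼 → 𝔼}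
    (hw : ∀ᵐ x ∂μ, w x ∈ subdifferential (explicitPotential y g') x)
    {g : Ω → Fin m → ℝ} {T : Ω → 𝔼 → 𝔼}
    (hT : ∀ᵐ ω ∂P, ∀ z, T ω z ∈ subdifferential (explicitPotential y (g ω)) z) :
    ∫⁻ ω, ∫⁻ x, ‖w x - T ω x‖ₑ ∂μ ∂P ≤ ENNReal.ofReal (2 * R) := by
  have h : ∀ᵐ ω ∂P, ∫⁻ x, ‖w x - T ω x‖ₑ ∂μ ≤ ENNReal.ofReal (2 * R) := by
    filter_upwards [hT] with ω hω
    calc ∫⁻ x, ‖w x - T ω x‖ₑ ∂μ ≤ ∫⁻ _, ENNReal.ofReal (2 * R) ∂μ := by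
          refine lintegral_mono_ae ?_
          filter_upwards [hw] with x hx
          rw [← ofReal_norm]
          refine ENNReal.ofReal_le_ofReal ((norm_sub_le _ _).trans ?_)
          linarith [norm_le_of_mem_subdifferential hy hx,
            norm_le_of_mem_subdifferential hy (hω x)]
      _ = ENNReal.ofReal (2 * R) := by simp
  calc ∫⁻ ω, ∫⁻ x, ‖w x - T ω x‖ₑ ∂μ ∂P ≤ ∫⁻ _, ENNReal.ofReal (2 * R) ∂P := lintegral_mono_ae h
    _ = ENNReal.ofReal (2 * R) := by simp

/-- The convergence rate in a fixed dimension, with `m / n = s ^ 8` for some `s ≤ 1`. -/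
theorem lintegral_enorm_sub_le_rateConst [NeZero m] [NeZero n] {M R : ℝ} (hM : 0 ≤ M) (hR : 0 ≤ R)
    (hball : ∀ᵐ x ∂μ, x ∈ Metric.ball (0 : 𝔼) R) (hdens : HasDensityBoundedBy μ M)
    (hX : ∀ i, HasLaw (X i) μ P) (hind : iIndepFun X P) {b : Fin m → ℝ} (hb : ∀ j, 0 < b j)
    {y : Fin m → 𝔼} (hy : ∀ j, ‖y j‖ ≤ R) {g' : Fin m → ℝ}
    (hmin : ∀ h, semidual μ b y g' ≤ semidual μ b y h) {w : 𝔼 → 𝔼}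
    (hw : ∀ᵐ x ∂μ, w x ∈ subdifferential (explicitPotential y g') x)
    {g : Ω → Fin m → ℝ} {T : Ω → 𝔼 → 𝔼}
    (hT : ∀ᵐ ω ∂P, IsMongeMapEstimator (fun _ => 1 / (n : ℝ)) (fun i => X i ω) b y (g ω) (T ω))
    {s : ℝ} (hs : 0 < s) (hs1 : s ≤ 1) (hs8 : (m : ℝ) = n * s ^ 8) :
    ∫⁻ ω, ∫⁻ x, ‖w x - T ω x‖ₑ ∂μ ∂P ≤ ENNReal.ofReal (rateConst M R d * s) := by
  have hn : (0 : ℝ) < n := Nat.cast_pos.2 (NeZero.pos n)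
  -- With `ε = s ^ 2` and `l = n * s ^ 2`, the grid error and the Hoeffding term are of order `s ^
  -- 2`, while the cardinality term `m / (ε * l)` is of order `s ^ 4`.
  obtain ⟨U, hUi, hU, hUle⟩ := exists_integrable_semidual_gap_bound hball hX hind hb hy
    (hT.mono fun ω h => h.1) g' (ε := s ^ 2) (l := n * s ^ 2) (by positivity)
    (pow_le_one₀ hs.le hs1) (by positivity)
  set V := volume.real (Metric.ball (0 : 𝔼) (R + 2)) with hV
  set H := 3 / 2 * R ^ 2 + (2 * R ^ 2 + 1) with hH
  have hUle' : ∫ ω, U ω ∂P ≤ (3 + 4 * R ^ 2 + H ^ 2 / 2) * s ^ 2 := by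
    refine hUle.trans ?_
    rw [hs8]
    have e : s ^ 2 + (n * s ^ 8 * (2 * (2 * R ^ 2 / s ^ 2 + 1))
        + H ^ 2 * (n * s ^ 2) ^ 2 / (2 * n)) / (n * s ^ 2)
        = s ^ 2 * (1 + 4 * R ^ 2 * s ^ 2 + 2 * s ^ 4 + H ^ 2 / 2) := by
      field_simp
      ring
    rw [e, mul_comm]
    have h2 : s ^ 2 ≤ 1 := pow_le_one₀ hs.le hs1
    have h4 : s ^ 4 ≤ 1 := pow_le_one₀ hs.le hs1
    have h5 : 4 * R ^ 2 * s ^ 2 ≤ 4 * R ^ 2 := mul_le_of_le_one_right (by positivity) h2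
    refine mul_le_mul_of_nonneg_right ?_ (by positivity)
    linarith
  set F : Ω → ℝ := fun ω => d * (2 * (M * (R * V)) * s + 2 * U ω / s) with hF
  have hFi : Integrable F P :=
    (((integrable_const _).add ((hUi.const_mul 2).div_const s)).const_mul _)
  have hF0 : 0 ≤ᵐ[P] F := by
    filter_upwards [hU] with ω hω
    have : 0 ≤ U ω := (sub_nonneg.2 (hmin _)).trans hω
    simp only [hF, Pi.zero_apply]
    positivity
  calc ∫⁻ ω, ∫⁻ x, ‖w x - T ω x‖ₑ ∂μ ∂P ≤ ∫⁻ ω, ENNReal.ofReal (F ω) ∂P := by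
        refine lintegral_mono_ae ?_
        filter_upwards [hU, hT] with ω hω hTω
        refine (lintegral_enorm_sub_le_semidual_gap hM hR hball hdens hy hmin hTω.2 hw hs
          hs1).trans (ENNReal.ofReal_le_ofReal ?_)
        simp only [hF]
        gcongr
    _ = ENNReal.ofReal (∫ ω, F ω ∂P) := (ofReal_integral_eq_lintegral_ofReal hFi hF0).symm
    _ ≤ _ := by
        refine ENNReal.ofReal_le_ofReal ?_
        rw [hF, integral_const_mul,
          integral_add (integrable_const _) ((hUi.const_mul 2).div_const s), integral_div,
          integral_const, probReal_univ, one_smul]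
        unfold rateConst
        rw [mul_assoc (d : ℝ), ← hV, ← hH]
        refine mul_le_mul_of_nonneg_left ?_ (by positivity)
        have : 2 * ∫ ω, U ω ∂P ≤ 2 * (3 + 4 * R ^ 2 + H ^ 2 / 2) * s * s := by
          nlinarith
        rw [add_mul]
        exact add_le_add le_rfl ((div_le_iff₀ hs).2 (by rwa [integral_const_mul]))

end Rate

end SemiDiscreteOT

end

theorem mainTheorem6 (M R : ℝ) (hM : 0 < M) (hR : 0 < R) :
    ∃ C : ℝ, 0 < C ∧
      ∀ (d : ℕ) (_ : 1 ≤ d)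
        -- the source measure
        (μ : Measure (EuclideanSpace ℝ (Fin d))) [IsProbabilityMeasure μ]
        (_ : μ.support ⊆ Metric.ball 0 R)
        (_ : SemiDiscreteOT.HasDensityBoundedBy μ M)
        -- the target measure `∑ j, b j δ_{y j}`
        (m : ℕ) (_ : 1 < m)
        (b : Fin m → ℝ) (_ : ∀ j, 0 < b j) (_ : ∑ j, b j = 1)
        (y : Fin m → EuclideanSpace ℝ (Fin d)) (_ : ∀ j, y j ∈ Metric.ball 0 R)
        -- an optimal Brenier potential
        (φ : EuclideanSpace ℝ (Fin d) → EReal)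
        (_ : SemiDiscreteOT.IsBrenierPotential μ (SemiDiscreteOT.discreteMeasure b y) φ),
        (∀ᵐ x ∂μ, SemiDiscreteOT.IsDifferentiableAt φ x) ∧
        ∀ (n : ℕ) (_ : 0 < n)
          -- the i.i.d. sample
          (Ω : Type*) [MeasurableSpace Ω] (P : Measure Ω) [IsProbabilityMeasure P]
          (X : Fin n → Ω → EuclideanSpace ℝ (Fin d))
          (_ : ∀ i, HasLaw (X i) μ P) (_ : iIndepFun X P)
          -- the estimator built from the empirical measure and the target
          (g : Ω → Fin m → ℝ) (_ : AEMeasurable g P)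
          (T : Ω → EuclideanSpace ℝ (Fin d) → EuclideanSpace ℝ (Fin d))
          (_ : ∀ᵐ ω ∂P, SemiDiscreteOT.IsMongeMapEstimator
            (fun _ => 1 / (n : ℝ)) (fun i => X i ω) b y (g ω) (T ω)),
          ∫⁻ ω, ∫⁻ x, ‖SemiDiscreteOT.grad φ x - T ω x‖ₑ ∂μ ∂P
            ≤ ENNReal.ofReal (C * ((m : ℝ) / n) ^ (1 / 8 : ℝ)) := by
  open SemiDiscreteOT in
  obtain ⟨d₀, hd₀⟩ := exists_dimension_bound M hR
  have hrate := rateConst_nonneg hM.le hR.le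
  have hsum0 : 0 ≤ ∑ d ∈ Finset.range d₀, rateConst M R d :=
    Finset.sum_nonneg fun d _ => hrate d
  -- The sum dominates the constant of every admissible dimension; `2 * R` covers the case `m ≥ n`.
  refine ⟨2 * R + ∑ d ∈ Finset.range d₀, rateConst M R d, by positivity, ?_⟩
  intro d _ μ _ hsupp hdens m hm b hb _ y hy φ hφ
  have : NeZero m := ⟨by omega⟩
  have hball : ∀ᵐ x ∂μ, x ∈ Metric.ball (0 : EuclideanSpace ℝ (Fin d)) R :=
    Filter.mem_of_superset Measure.support_mem_ae hsupp
  have hy' : ∀ j, ‖y j‖ ≤ R := fun j => (mem_ball_zero_iff.1 (hy j)).le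
  have hdR : rateConst M R d ≤ ∑ d ∈ Finset.range d₀, rateConst M R d :=
    Finset.single_le_sum (f := rateConst M R) (fun d _ => hrate d)
      (Finset.mem_range.2 (hd₀ d μ hball hdens))
  have hac : μ ≪ volume := by
    obtain ⟨ρ, -, -, rfl⟩ := hdens
    exact withDensity_absolutelyContinuous _ _
  obtain ⟨g', hmin, hbelow, hae⟩ :=
    exists_explicitPotential_of_isBrenierPotential hR.le hball hb hφ
  have hdiff : ∀ᵐ x ∂μ, IsDifferentiableAt φ x :=
    ae_isDifferentiableAt hac hφ.1 (hae.mono fun x hx => by rw [hx]; exact EReal.coe_ne_top _)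
  refine ⟨hdiff, ?_⟩
  intro n hn Ω _ P _ X hX hind g _ T hT
  have : NeZero n := ⟨hn.ne'⟩
  -- Where `φ` is differentiable and touches `φ_{g'}` from above, its gradient is the `y k` of an
  -- active piece.
  have hw : ∀ᵐ x ∂μ, grad φ x ∈ subdifferential (explicitPotential y g') x := by
    filter_upwards [hdiff, hae] with x h1 h2
    obtain ⟨k, hk⟩ := exists_affinePiece_eq_explicitPotential y g' x
    have hv := mem_subdifferential_of_affinePiece_eq hk
    rwa [grad_eq_of_mem_subdifferential h1 hbelow h2 hv]
  have hn' : (0 : ℝ) < n := Nat.cast_pos.2 hn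
  have hm' : (0 : ℝ) < m := Nat.cast_pos.2 (by omega)
  set s : ℝ := ((m : ℝ) / n) ^ (1 / 8 : ℝ) with hs
  have hs0 : 0 < s := Real.rpow_pos_of_pos (by positivity) _
  rcases le_total ((m : ℝ) / n) 1 with hmn | hmn
  · have hs8 : (m : ℝ) = n * s ^ 8 := by
      rw [hs, ← Real.rpow_natCast, ← Real.rpow_mul (by positivity)]
      norm_num
      field_simp
    refine (lintegral_enorm_sub_le_rateConst hM.le hR.le hball hdens hX hind hb hy' hmin hw hT hs0
      (Real.rpow_le_one (by positivity) hmn (by norm_num)) hs8).trans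
      (ENNReal.ofReal_le_ofReal (mul_le_mul_of_nonneg_right ?_ hs0.le))
    linarith
  · have hs1 : 1 ≤ s := Real.one_le_rpow hmn (by norm_num)
    refine (lintegral_enorm_sub_le_two_mul hy' hw (hT.mono fun ω h => h.2)).trans
      (ENNReal.ofReal_le_ofReal ?_)
    calc 2 * R ≤ 2 * R * s := le_mul_of_one_le_right (by positivity) hs1
      _ ≤ _ := mul_le_mul_of_nonneg_right (by linarith) hs0.le
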